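/- Let $0\le\alpha\le 1/2$ and $\beta>0$ be real numbers, and let $$\Omega=[0,\alpha)\cup[\alpha+\beta,\,1+\beta).$$ Assume that $\alpha<1/2$, or that $\alpha=1/2$ and $\beta\ge 1/2$. For $\lambda=(t,\nu)\in\mathbb{R}^2$ put $g_\lambda(x)=\chi_\Omega(x-t)\,e^{2\pi i x\nu}$. We say that there is a Gabor orthonormal basis with window $\chi_\Omega$ if there is a countable discrete set $\Lambda\subset\mathbb{R}^2$ such that $\{g_\lambda\}_{\lambda\in\Lambda}$ is an orthonormal basis of $L^2(\mathbb{R})$. We say that $\Omega$ tiles $\mathbb{R}$ if there is a set $T\subset\mathbb{R}$ with $\sum_{t\in T}\chi_\Omega(x-t)=1$ for almost every $x\in\mathbb{R}$. Then there is a Gabor orthonormal basis with window $\chi_\Omega$ if and only if $\Omega$ tiles $\mathbb{R}$. Moreover, if $\alpha>0$, this occurs exactly when one of the following conditions holds: (i) $0<\alpha<1/2$ and $\beta\in\mathbb{N}=\{1,2,\dots\}$; (ii) $\alpha=1/2$ and $\beta\in\tfrac12\mathbb{N}$. -/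

import Mathlib

open MeasureTheory
open scoped ENNReal

noncomputable section

/-- The set `[0, α) ∪ [α + β, 1 + β)`. -/
def twoIntervals (α β : ℝ) : Set ℝ :=
  Set.Ico 0 α ∪ Set.Ico (α + β) (1 + β)

/-- The characteristic function of a set of reals, as a complex-valued window. -/
def charWindow (Ω : Set ℝ) : ℝ → ℂ :=
  Ω.indicator (fun _ => 1)

/-- The time-frequency shift `g_{(t, ν)}(x) = g (x - t) * exp (2 π i x ν)`. -/
def timeFreqShift (g : ℝ → ℂ) (p : ℝ × ℝ) : ℝ → ℂ :=
  fun x => g (x - p.1) * Complex.exp (2 * Real.pi * Complex.I * (x * p.2 : ℝ))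

/-- The Gabor system `{g_p}_{p ∈ Λ}`, indexed by a discrete countable set `Λ` of the
time-frequency plane, is an orthonormal basis of `L²(ℝ)`. -/
def IsGaborONB (g : ℝ → ℂ) (Λ : Set (ℝ × ℝ)) : Prop :=
  Λ.Countable ∧ IsDiscrete Λ ∧
    ∃ b : HilbertBasis Λ ℂ (Lp ℂ 2 (volume : Measure ℝ)),
      ∀ p : Λ, (b p : ℝ → ℂ) =ᵐ[volume] timeFreqShift g p

/-- `Ω` tiles the real line by translations: for some set `T` of translations,
`∑_{t ∈ T} χ_Ω(x - t) = 1` for almost every `x` (the sum is taken in `[0, ∞]`). -/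
def TilesLine (Ω : Set ℝ) : Prop :=
  ∃ T : Set ℝ, ∀ᵐ x ∂(volume : Measure ℝ),
    ∑' t : T, Ω.indicator (fun _ => (1 : ℝ≥0∞)) (x - t) = 1

end

/-! Let A be the ambiguity function of χ_Ω. Up to a unimodular factor, A(q - p) is the inner product
of g_p and g_q, and |A|² has integral |Ω|² = 1 over the plane. For a Gabor basis Λ, A vanishes on
nonzero differences of Λ, and Parseval's identity applied to the time-frequency shifts of χ_Ω
themselves gives ∑_p |A(w - p)|² = 1 for every w. Hence, if the translates D + p with p in Λ are
disjoint, convolving |A|² with the indicator of their union gives the constant |D|. So |D| ≤ 1, and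
if |D| = 1 the translates cover almost everything (`IsGaborONB.volume_packing_le_one`,
`IsGaborONB.ae_mem_packing`).

The zeros of A tell which D pack. For 0 < α < 1/2 and β < 1 - α, a box of area greater than 1 packs,
so there is no basis. For 0 < α < 1/2 and β ≥ 1 - α, the set Ω × [0, 1) packs with area 1, hence
tiles the plane, and a horizontal slice is a tiling by Ω. For α = 1/2 and β ≥ 1/2, Ω times
`halfPeriods (β + 1/2)` packs, and its area exceeds 1 unless 2β is an integer.

Following the neighbours of a translate in a tiling determines β (`TilesLine.exists_nat`,
`TilesLine.exists_nat_half`). Conversely, each admissible Ω tiles by some T and has an orthogonal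
basis of exponentials with frequencies S, and T × S indexes a Gabor basis
(`isGaborONB_of_tiling_of_spectrum`). -/

noncomputable section

/-! ### Exponentials and the ambiguity function. -/

/-- The exponential `x ↦ exp (2 π i x ν)`. -/
def freqExp (ν x : ℝ) : ℂ := Complex.exp (2 * Real.pi * Complex.I * (x * ν : ℝ))

lemma timeFreqShift_apply (g : ℝ → ℂ) (p : ℝ × ℝ) (x : ℝ) :
    timeFreqShift g p x = g (x - p.1) * freqExp p.2 x := rfl

lemma freqExp_add_freq (ν μ x : ℝ) : freqExp (ν + μ) x = freqExp ν x * freqExp μ x := by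
  simp only [freqExp, ← Complex.exp_add]
  congr 1
  push_cast
  ring

lemma freqExp_add (ν x y : ℝ) : freqExp ν (x + y) = freqExp ν x * freqExp ν y := by
  simp only [freqExp, ← Complex.exp_add]
  congr 1
  push_cast
  ring

lemma freqExp_ne_zero (ν x : ℝ) : freqExp ν x ≠ 0 := Complex.exp_ne_zero _

lemma conj_freqExp (ν x : ℝ) : (starRingEnd ℂ) (freqExp ν x) = freqExp (-ν) x := by
  simp only [freqExp, ← Complex.exp_conj]
  congr 1
  simp [Complex.conj_ofNat]

lemma norm_freqExp (ν x : ℝ) : ‖freqExp ν x‖ = 1 := by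
  rw [freqExp, show (2 * Real.pi * Complex.I * (x * ν : ℝ) : ℂ)
    = ((2 * Real.pi * (x * ν) : ℝ) : ℂ) * Complex.I by push_cast; ring]
  exact Complex.norm_exp_ofReal_mul_I _

lemma continuous_freqExp_uncurry : Continuous fun p : ℝ × ℝ => freqExp p.1 p.2 := by
  unfold freqExp
  fun_prop

lemma continuous_freqExp (ν : ℝ) : Continuous (freqExp ν) := by
  unfold freqExp
  fun_prop

/-- The part of `Ω` which is also covered by the translate `Ω + t`. -/
def overlap (Ω : Set ℝ) (t : ℝ) : Set ℝ := Ω ∩ (fun x => x - t) ⁻¹' Ω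

/-- The ambiguity function of the indicator of `Ω`. -/
def ambiguity (Ω : Set ℝ) (p : ℝ × ℝ) : ℂ := ∫ x in overlap Ω p.1, freqExp p.2 x

lemma measurableSet_overlap {Ω : Set ℝ} (hΩ : MeasurableSet Ω) (t : ℝ) :
    MeasurableSet (overlap Ω t) :=
  hΩ.inter ((measurable_id.sub_const t) hΩ)

/-- The substitution x ↦ x + p.1 leaves a dependence on q - p only, apart from a unimodular factor.
-/
lemma integral_conj_timeFreqShift_mul {Ω : Set ℝ} (hΩ : MeasurableSet Ω) (p q : ℝ × ℝ) :
    ∫ x, (starRingEnd ℂ) (timeFreqShift (charWindow Ω) p x) * timeFreqShift (charWindow Ω) q x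
      = freqExp (q.2 - p.2) p.1 * ambiguity Ω (q - p) := by
  rw [ambiguity, ← integral_indicator (measurableSet_overlap hΩ _), ← integral_const_mul,
    ← integral_add_right_eq_self _ p.1]
  congr 1 with x
  have hx : x + p.1 - q.1 = x - (q - p).1 := by
    rw [Prod.fst_sub]
    ring
  rw [timeFreqShift_apply, timeFreqShift_apply, add_sub_cancel_right, hx, map_mul, conj_freqExp]
  have h : freqExp (-p.2) (x + p.1) * freqExp q.2 (x + p.1)
      = freqExp (q.2 - p.2) p.1 * freqExp (q.2 - p.2) x := by
    rw [← freqExp_add_freq, ← freqExp_add]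
    ring_nf
  by_cases h1 : x ∈ Ω <;> by_cases h2 : x - (q - p).1 ∈ Ω
  · have h3 : x ∈ overlap Ω (q - p).1 := ⟨h1, h2⟩
    simpa [-Prod.fst_sub, charWindow, h1, h2, h3] using h
  all_goals
    have h3 : x ∉ overlap Ω (q - p).1 := fun h3 => by simp_all [overlap]
    simp [-Prod.fst_sub, charWindow, h1, h2, h3]

/-! ### Plancherel's identity for the ambiguity function. -/

/-- Parseval on (a, b] for the indicator of E times `freqExp θ`: the integrals are its Fourier
coefficients, up to the factor b - a and the sign of n. -/
lemma hasSum_sq_norm_integral_freqExp {E : Set ℝ} (hE : MeasurableSet E) {a b : ℝ} (hab : a < b)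
    (hEab : E ⊆ Set.Ioc a b) (θ : ℝ) :
    HasSum (fun n : ℤ => ‖∫ x in E, freqExp (θ + n * (b - a)⁻¹) x‖ ^ 2)
      ((b - a) * (volume E).toReal) := by
  have hba : 0 < b - a := sub_pos.2 hab
  have hfin : volume E ≠ ∞ := ((measure_mono hEab).trans_lt measure_Ioc_lt_top).ne
  set f : ℝ → ℂ := E.indicator (freqExp θ) with hf
  have hmem : MemLp f 2 (volume.restrict (Set.Ioc a b)) := by
    refine MemLp.of_bound ((continuous_freqExp θ).aestronglyMeasurable.indicator hE) 1 ?_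
    refine Filter.Eventually.of_forall fun x => ?_
    rw [hf, Set.indicator]
    split_ifs <;> simp [norm_freqExp]
  have h := hasSum_sq_fourierCoeffOn hab hmem
  have hval : ∫ x in a..b, ‖f x‖ ^ 2 = (volume E).toReal := by
    rw [intervalIntegral.integral_of_le hab.le]
    have : (fun x => ‖f x‖ ^ 2) = E.indicator (fun _ => (1 : ℝ)) := by
      ext x
      rw [hf, Set.indicator, Set.indicator]
      split_ifs <;> simp [norm_freqExp]
    rw [this, integral_indicator hE, Measure.restrict_restrict hE, Set.inter_eq_left.2 hEab]
    simp [Measure.real]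
  have hcoef : ∀ n : ℤ, ∫ x in E, freqExp (θ + (-n : ℤ) * (b - a)⁻¹) x
      = (b - a) * fourierCoeffOn hab f n := by
    intro n
    rw [fourierCoeffOn_eq_integral, intervalIntegral.integral_of_le hab.le]
    have : (fun x : ℝ => fourier (-n) (x : AddCircle (b - a)) • f x)
        = E.indicator (fun x => freqExp (θ + (-n : ℤ) * (b - a)⁻¹) x) := by
      ext x
      rw [hf, Set.indicator, Set.indicator]
      split_ifs
      · rw [fourier_coe_apply, freqExp_add_freq, smul_eq_mul, mul_comm]
        congr 2
        push_cast
        field_simp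
      · simp
    rw [this, integral_indicator hE, Measure.restrict_restrict hE, Set.inter_eq_left.2 hEab,
      Complex.real_smul, ← mul_assoc]
    have : ((b : ℂ) - a) ≠ 0 := by exact_mod_cast hba.ne'
    push_cast
    field_simp
  rw [hval] at h
  have h2 := h.mul_left ((b - a) ^ 2)
  rw [← (Equiv.neg ℤ).hasSum_iff]
  have hfun : (fun n : ℤ => ‖∫ x in E, freqExp (θ + n * (b - a)⁻¹) x‖ ^ 2) ∘ Equiv.neg ℤ
      = fun n => (b - a) ^ 2 * ‖fourierCoeffOn hab f n‖ ^ 2 := by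
    ext n
    rw [Function.comp_apply, Equiv.neg_apply, hcoef n, norm_mul, mul_pow, ← Complex.ofReal_sub,
      Complex.norm_real, Real.norm_eq_abs, sq_abs]
  rw [hfun, show (b - a) * (volume E).toReal = (b - a) ^ 2 * (b - a)⁻¹ • (volume E).toReal by
    rw [smul_eq_mul]; field_simp]
  exact h2

/-- Plancherel's identity for the indicator of a bounded set. -/
lemma lintegral_sq_enorm_integral_freqExp {E : Set ℝ} (hE : MeasurableSet E) {a b : ℝ}
    (hab : a < b) (hEab : E ⊆ Set.Ioc a b) :
    ∫⁻ μ, ‖∫ x in E, freqExp μ x‖ₑ ^ 2 = volume E := by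
  have hba : 0 < b - a := sub_pos.2 hab
  have hfin : volume E ≠ ∞ := ((measure_mono hEab).trans_lt measure_Ioc_lt_top).ne
  set c := (b - a)⁻¹ with hc
  have hcpos : 0 < c := inv_pos.2 hba
  set h : ℝ → ℝ≥0∞ := fun μ => ‖∫ x in E, freqExp μ x‖ₑ ^ 2 with hh
  have hmeas : Measurable h := by
    have : StronglyMeasurable fun μ => ∫ x in E, freqExp μ x :=
      StronglyMeasurable.integral_prod_right
        (f := fun μ x => freqExp μ x) continuous_freqExp_uncurry.stronglyMeasurable
    exact this.enorm.pow_const 2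
  -- The periodization of `h` with period c = 1/(b - a) is constant, so the integral over the line
  -- is that constant times the length c of one cell.
  have key : ∀ θ, ∑' n : ℤ, h (θ + n * c) = ENNReal.ofReal (b - a) * volume E := by
    intro θ
    have hs := hasSum_sq_norm_integral_freqExp hE hab hEab θ
    rw [← ENNReal.ofReal_toReal hfin, ← ENNReal.ofReal_mul hba.le, ← hs.tsum_eq,
      ENNReal.ofReal_tsum_of_nonneg (fun n => by positivity) hs.summable]
    congr 1 with n
    rw [hh, ENNReal.ofReal_pow (norm_nonneg _), ofReal_norm]
  calc ∫⁻ μ, h μ = ∫⁻ μ in ⋃ n : ℤ, Set.Ico (0 + n • c) (0 + (n + 1) • c), h μ := by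
        rw [iUnion_Ico_add_zsmul hcpos, Measure.restrict_univ]
    _ = ∑' n : ℤ, ∫⁻ μ in Set.Ico (0 + n • c) (0 + (n + 1) • c), h μ :=
        lintegral_iUnion (fun _ => measurableSet_Ico) (Set.pairwise_disjoint_Ico_add_zsmul _ _) _
    _ = ∑' n : ℤ, ∫⁻ θ in Set.Ico 0 c, h (θ + n * c) := by
        congr 1 with n
        rw [← lintegral_indicator measurableSet_Ico, ← lintegral_indicator measurableSet_Ico,
          ← lintegral_add_right_eq_self _ (n * c)]
        congr 1 with θ
        simp only [Set.indicator, Set.mem_Ico, zsmul_eq_mul, Int.cast_add, Int.cast_one]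
        congr 1
        simp only [eq_iff_iff]
        constructor <;> rintro ⟨h1, h2⟩ <;> constructor <;> linarith
    _ = ∫⁻ θ in Set.Ico 0 c, ∑' n : ℤ, h (θ + n * c) :=
        (lintegral_tsum fun n => (hmeas.comp (measurable_add_const _)).aemeasurable).symm
    _ = volume E := by
        simp only [key]
        rw [setLIntegral_const, Real.volume_Ico, sub_zero, mul_right_comm,
          ← ENNReal.ofReal_mul hba.le, hc, mul_inv_cancel₀ hba.ne', ENNReal.ofReal_one, one_mul]


lemma measurable_ambiguity {Ω : Set ℝ} (hΩ : MeasurableSet Ω) : Measurable (ambiguity Ω) := by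
  have hS : MeasurableSet {q : (ℝ × ℝ) × ℝ | q.2 ∈ overlap Ω q.1.1} :=
    (measurable_snd hΩ).inter ((measurable_snd.sub (measurable_fst.comp measurable_fst)) hΩ)
  have hf : StronglyMeasurable ({q : (ℝ × ℝ) × ℝ | q.2 ∈ overlap Ω q.1.1}.indicator
      fun q => freqExp q.1.2 q.2) := by
    refine StronglyMeasurable.indicator (Continuous.stronglyMeasurable ?_) hS
    exact continuous_freqExp_uncurry.comp (by fun_prop : Continuous fun q : (ℝ × ℝ) × ℝ =>
      (q.1.2, q.2))
  have := StronglyMeasurable.integral_prod_right' (ν := (volume : Measure ℝ)) hf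
  convert this.measurable using 1
  ext p
  rw [ambiguity, ← integral_indicator (measurableSet_overlap hΩ _)]
  rfl

lemma lintegral_volume_overlap {Ω : Set ℝ} (hΩ : MeasurableSet Ω) :
    ∫⁻ t, volume (overlap Ω t) = volume Ω * volume Ω := by
  have h1 : ∀ t, volume (overlap Ω t)
      = ∫⁻ x, Ω.indicator 1 x * Ω.indicator 1 (x - t) := by
    intro t
    rw [← lintegral_indicator_one (measurableSet_overlap hΩ t)]
    congr 1 with x
    by_cases h1 : x ∈ Ω <;> by_cases h2 : x - t ∈ Ω <;> simp [overlap, h1, h2]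
  have hm : Measurable (Ω.indicator (1 : ℝ → ℝ≥0∞)) := measurable_one.indicator hΩ
  simp_rw [h1]
  rw [lintegral_lintegral_swap]
  · have h2 : ∀ x, ∫⁻ t, Ω.indicator (1 : ℝ → ℝ≥0∞) x * Ω.indicator 1 (x - t)
        = Ω.indicator 1 x * volume Ω := by
      intro x
      have hx : Measurable fun t => Ω.indicator (1 : ℝ → ℝ≥0∞) (x - t) :=
        hm.comp (measurable_const.sub measurable_id)
      rw [lintegral_const_mul _ hx, lintegral_sub_left_eq_self, lintegral_indicator_one hΩ]
    simp_rw [h2]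
    rw [lintegral_mul_const _ hm, lintegral_indicator_one hΩ]
  · exact ((hm.comp measurable_snd).mul
      (hm.comp (measurable_snd.sub measurable_fst))).aemeasurable

lemma lintegral_sq_enorm_ambiguity {Ω : Set ℝ} (hΩ : MeasurableSet Ω) {a b : ℝ} (hab : a < b)
    (hΩab : Ω ⊆ Set.Ioc a b) :
    ∫⁻ p, ‖ambiguity Ω p‖ₑ ^ 2 = volume Ω * volume Ω := by
  rw [Measure.volume_eq_prod,
    lintegral_prod _ ((measurable_ambiguity hΩ).enorm.pow_const 2).aemeasurable,
    ← lintegral_volume_overlap hΩ]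
  congr 1 with t
  exact lintegral_sq_enorm_integral_freqExp (measurableSet_overlap hΩ t) hab
    (Set.inter_subset_left.trans hΩab)

/-! ### Orthogonality and Parseval for a Gabor basis. -/

lemma memLp_timeFreqShift {Ω : Set ℝ} (hΩ : MeasurableSet Ω) (hfin : volume Ω ≠ ∞)
    (p : ℝ × ℝ) : MemLp (timeFreqShift (charWindow Ω) p) 2 volume := by
  have h : timeFreqShift (charWindow Ω) p
      = ((fun x => x - p.1) ⁻¹' Ω).indicator (freqExp p.2) := by
    ext x
    by_cases hx : x - p.1 ∈ Ω <;> simp [timeFreqShift_apply, charWindow, hx]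
  have hS : MeasurableSet ((fun x => x - p.1) ⁻¹' Ω) := (measurable_id.sub_const p.1) hΩ
  have hvol : volume ((fun x => x - p.1) ⁻¹' Ω) = volume Ω :=
    (measurePreserving_sub_right volume p.1).measure_preimage hΩ.nullMeasurableSet
  rw [h, memLp_indicator_iff_restrict hS]
  have : IsFiniteMeasure (volume.restrict ((fun x => x - p.1) ⁻¹' Ω)) :=
    ⟨by rw [Measure.restrict_apply_univ, hvol]; exact hfin.lt_top⟩
  exact MemLp.of_bound (continuous_freqExp _).aestronglyMeasurable 1
    (Filter.Eventually.of_forall fun x => (norm_freqExp _ _).le)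

lemma inner_timeFreqShift {Ω : Set ℝ} (hΩ : MeasurableSet Ω) {p q : ℝ × ℝ}
    {f g : Lp ℂ 2 (volume : Measure ℝ)} (hf : f =ᵐ[volume] timeFreqShift (charWindow Ω) p)
    (hg : g =ᵐ[volume] timeFreqShift (charWindow Ω) q) :
    inner ℂ f g = freqExp (q.2 - p.2) p.1 * ambiguity Ω (q - p) := by
  rw [← integral_conj_timeFreqShift_mul hΩ, L2.inner_def]
  refine integral_congr_ae ?_
  filter_upwards [hf, hg] with x hx hy
  rw [hx, hy, RCLike.inner_apply, mul_comm]

lemma ambiguity_zero (Ω : Set ℝ) : ambiguity Ω 0 = (volume Ω).toReal := by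
  simp [ambiguity, overlap, freqExp, Measure.real]

lemma IsGaborONB.ambiguity_eq_zero {Ω : Set ℝ} (hΩ : MeasurableSet Ω) {Λ : Set (ℝ × ℝ)}
    (h : IsGaborONB (charWindow Ω) Λ) {p q : ℝ × ℝ} (hp : p ∈ Λ) (hq : q ∈ Λ) (hpq : p ≠ q) :
    ambiguity Ω (q - p) = 0 := by
  obtain ⟨-, -, b, hb⟩ := h
  have h0 := b.orthonormal.2 (i := ⟨p, hp⟩) (j := ⟨q, hq⟩) (by simpa using hpq)
  beta_reduce at h0
  rw [inner_timeFreqShift hΩ (hb _) (hb _)] at h0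
  exact (mul_eq_zero.1 h0).resolve_left (freqExp_ne_zero _ _)

/-- Parseval for the shifted window g_w, where w need not lie in Λ: the translates of |A|² by Λ tile
the plane with weights. -/
lemma IsGaborONB.tsum_sq_enorm_ambiguity {Ω : Set ℝ} (hΩ : MeasurableSet Ω)
    (hfin : volume Ω ≠ ∞) {Λ : Set (ℝ × ℝ)} (h : IsGaborONB (charWindow Ω) Λ) (w : ℝ × ℝ) :
    ∑' p : Λ, ‖ambiguity Ω (w - p)‖ₑ ^ 2 = volume Ω := by
  obtain ⟨-, -, b, hb⟩ := h
  set f := (memLp_timeFreqShift hΩ hfin w).toLp with hf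
  have hfw : f =ᵐ[volume] timeFreqShift (charWindow Ω) w := MemLp.coeFn_toLp _
  have hs := b.hasSum_inner_mul_inner f f
  have hterm : ∀ p : Λ, inner ℂ f (b p) * inner ℂ (b p) f
      = ((‖ambiguity Ω (w - p)‖ ^ 2 : ℝ) : ℂ) := by
    intro p
    rw [← inner_conj_symm f (b p), ← Complex.normSq_eq_conj_mul_self, Complex.normSq_eq_norm_sq,
      inner_timeFreqShift hΩ (hb p) hfw, norm_mul, norm_freqExp, one_mul]
  simp_rw [hterm] at hs
  rw [inner_timeFreqShift hΩ hfw hfw, sub_self, sub_self, ambiguity_zero,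
    show freqExp 0 w.1 = 1 by simp [freqExp], one_mul, Complex.hasSum_ofReal] at hs
  rw [← ENNReal.ofReal_toReal hfin, ← hs.tsum_eq,
    ENNReal.ofReal_tsum_of_nonneg (fun n => by positivity) hs.summable]
  congr 1 with p
  rw [ENNReal.ofReal_pow (norm_nonneg _), ofReal_norm]

/-! ### Packings by translates along Λ. -/

lemma tsum_indicator_sub_eq {Λ D : Set (ℝ × ℝ)}
    (hpack : ∀ p ∈ Λ, ∀ q ∈ Λ, ∀ w, w - p ∈ D → w - q ∈ D → p = q) (w : ℝ × ℝ) :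
    ∑' p : Λ, D.indicator (1 : ℝ × ℝ → ℝ≥0∞) (w - p)
      = {w | ∃ p ∈ Λ, w - p ∈ D}.indicator 1 w := by
  by_cases hw : ∃ p ∈ Λ, w - p ∈ D
  · obtain ⟨p, hp, hpD⟩ := hw
    rw [tsum_eq_single ⟨p, hp⟩, Set.indicator_of_mem hpD, Set.indicator_of_mem]
    · rfl
    · exact ⟨p, hp, hpD⟩
    · intro q hq
      exact Set.indicator_of_notMem (fun hqD => hq (Subtype.ext (hpack _ q.2 p hp w hqD hpD))) _
  · rw [Set.indicator_of_notMem (by exact hw), ENNReal.tsum_eq_zero]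
    exact fun p => Set.indicator_of_notMem (fun hD => hw ⟨p, p.2, hD⟩) _

section Packing

variable {Ω : Set ℝ} {Λ D : Set (ℝ × ℝ)}

lemma measurableSet_packing (hΛ : Λ.Countable) (hD : MeasurableSet D) :
    MeasurableSet {w | ∃ p ∈ Λ, w - p ∈ D} := by
  have : {w | ∃ p ∈ Λ, w - p ∈ D} = ⋃ p ∈ Λ, (fun w => w - p) ⁻¹' D := by
    ext w
    simp
  rw [this]
  exact MeasurableSet.biUnion hΛ fun p _ => (measurable_id.sub_const p) hD

/-- Disjointness turns the indicator of the union into a sum over Λ. The change of variable v = z -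
p - d moves the translation onto |A|², whose sum over Λ is 1, and the indicator of D remains. -/
lemma IsGaborONB.lintegral_packing (hΩ : MeasurableSet Ω) (hvol : volume Ω = 1)
    (h : IsGaborONB (charWindow Ω) Λ) (hD : MeasurableSet D)
    (hpack : ∀ p ∈ Λ, ∀ q ∈ Λ, ∀ w, w - p ∈ D → w - q ∈ D → p = q) (z : ℝ × ℝ) :
    ∫⁻ v, ‖ambiguity Ω v‖ₑ ^ 2 * {w | ∃ p ∈ Λ, w - p ∈ D}.indicator 1 (z - v) = volume D := by
  have : Countable Λ := h.1.to_subtype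
  have hF : Measurable fun v => ‖ambiguity Ω v‖ₑ ^ 2 := (measurable_ambiguity hΩ).enorm.pow_const 2
  have hm : Measurable (D.indicator (1 : ℝ × ℝ → ℝ≥0∞)) := measurable_one.indicator hD
  calc ∫⁻ v, ‖ambiguity Ω v‖ₑ ^ 2 * {w | ∃ p ∈ Λ, w - p ∈ D}.indicator 1 (z - v)
      = ∫⁻ v, ∑' p : Λ, ‖ambiguity Ω v‖ₑ ^ 2 * D.indicator 1 (z - v - p) := by
        simp_rw [← tsum_indicator_sub_eq hpack, ENNReal.tsum_mul_left]
    _ = ∑' p : Λ, ∫⁻ v, ‖ambiguity Ω v‖ₑ ^ 2 * D.indicator 1 (z - v - p) :=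
        lintegral_tsum fun p => (hF.mul
          (hm.comp ((measurable_const.sub measurable_id).sub_const _))).aemeasurable
    _ = ∑' p : Λ, ∫⁻ d, ‖ambiguity Ω (z - d - p)‖ₑ ^ 2 * D.indicator 1 d := by
        congr 1 with p
        rw [← lintegral_sub_left_eq_self _ (z - p)]
        congr 1 with d
        rw [show z - (z - ↑p - d) - ↑p = d by abel, show z - ↑p - d = z - d - ↑p by abel]
    _ = ∫⁻ d, ∑' p : Λ, ‖ambiguity Ω (z - d - p)‖ₑ ^ 2 * D.indicator 1 d :=
        (lintegral_tsum fun p => ((hF.comp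
          ((measurable_const.sub measurable_id).sub_const _)).mul hm).aemeasurable).symm
    _ = volume D := by
        simp_rw [ENNReal.tsum_mul_right, h.tsum_sq_enorm_ambiguity hΩ (by simp [hvol]), hvol,
          one_mul]
        exact lintegral_indicator_one hD

/-- A packing by translates along a Gabor orthonormal basis has density at most one. -/
lemma IsGaborONB.volume_packing_le_one (hΩ : MeasurableSet Ω) {a b : ℝ} (hab : a < b)
    (hΩab : Ω ⊆ Set.Ioc a b) (hvol : volume Ω = 1)
    (h : IsGaborONB (charWindow Ω) Λ) (hD : MeasurableSet D)
    (hpack : ∀ p ∈ Λ, ∀ q ∈ Λ, ∀ w, w - p ∈ D → w - q ∈ D → p = q) : volume D ≤ 1 := by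
  rw [← h.lintegral_packing hΩ hvol hD hpack 0]
  calc _ ≤ ∫⁻ v, ‖ambiguity Ω v‖ₑ ^ 2 := by
        refine lintegral_mono fun v => mul_le_of_le_one_right' ?_
        exact Set.indicator_le_self' (fun _ _ => zero_le) _
    _ = 1 := by rw [lintegral_sq_enorm_ambiguity hΩ hab hΩab, hvol, one_mul]

/-- A packing of density one by translates along a Gabor orthonormal basis is a tiling. -/
lemma IsGaborONB.ae_mem_packing (hΩ : MeasurableSet Ω) {a b : ℝ} (hab : a < b)
    (hΩab : Ω ⊆ Set.Ioc a b) (hvol : volume Ω = 1)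
    (h : IsGaborONB (charWindow Ω) Λ) (hD : MeasurableSet D) (hD1 : volume D = 1)
    (hpack : ∀ p ∈ Λ, ∀ q ∈ Λ, ∀ w, w - p ∈ D → w - q ∈ D → p = q) :
    ∀ᵐ w : ℝ × ℝ, ∃ p ∈ Λ, w - p ∈ D := by
  set U := {w | ∃ p ∈ Λ, w - p ∈ D} with hU
  have hUm : MeasurableSet U := measurableSet_packing h.1 hD
  have hF : Measurable fun v => ‖ambiguity Ω v‖ₑ ^ 2 := (measurable_ambiguity hΩ).enorm.pow_const 2
  have hF1 : ∫⁻ v, ‖ambiguity Ω v‖ₑ ^ 2 = 1 := by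
    rw [lintegral_sq_enorm_ambiguity hΩ hab hΩab, hvol, one_mul]
  have hm : Measurable (U.indicator (1 : ℝ × ℝ → ℝ≥0∞)) := measurable_one.indicator hUm
  have hmc : Measurable (Uᶜ.indicator (1 : ℝ × ℝ → ℝ≥0∞)) := measurable_one.indicator hUm.compl
  -- |A|² has total mass 1, and its convolution with the indicator of `U` is already |D| = 1, so
  -- nothing is left for the complement. By Tonelli, integrating over z recovers the measure of
  -- `Uᶜ`.
  have hzero : ∀ z, ∫⁻ v, ‖ambiguity Ω v‖ₑ ^ 2 * Uᶜ.indicator 1 (z - v) = 0 := by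
    intro z
    have hadd : (∫⁻ v, ‖ambiguity Ω v‖ₑ ^ 2 * U.indicator 1 (z - v))
        + ∫⁻ v, ‖ambiguity Ω v‖ₑ ^ 2 * Uᶜ.indicator 1 (z - v) = 1 := by
      have hz : Measurable fun v => ‖ambiguity Ω v‖ₑ ^ 2 * U.indicator 1 (z - v) :=
        hF.mul (hm.comp (measurable_const.sub measurable_id))
      rw [← hF1, ← lintegral_add_left hz]
      congr 1 with v
      rw [← mul_add]
      by_cases hv : z - v ∈ U <;> simp [hv]
    rw [h.lintegral_packing hΩ hvol hD hpack z, hD1] at hadd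
    exact (ENNReal.add_right_inj ENNReal.one_ne_top).1 (hadd.trans (add_zero 1).symm)
  have hswap : ∫⁻ z : ℝ × ℝ, ∫⁻ v, ‖ambiguity Ω v‖ₑ ^ 2 * Uᶜ.indicator 1 (z - v)
      = volume Uᶜ := by
    rw [lintegral_lintegral_swap]
    · have h2 : ∀ v : ℝ × ℝ, ∫⁻ z : ℝ × ℝ, ‖ambiguity Ω v‖ₑ ^ 2 * Uᶜ.indicator 1 (z - v)
          = ‖ambiguity Ω v‖ₑ ^ 2 * volume Uᶜ := by
        intro v
        have hv : Measurable fun z => Uᶜ.indicator (1 : ℝ × ℝ → ℝ≥0∞) (z - v) :=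
          hmc.comp (measurable_id.sub_const v)
        rw [lintegral_const_mul _ hv, lintegral_sub_right_eq_self, lintegral_indicator_one hUm.compl]
      simp_rw [h2]
      rw [lintegral_mul_const _ hF, hF1, one_mul]
    · exact ((hF.comp measurable_snd).mul
        (hmc.comp (measurable_fst.sub measurable_snd))).aemeasurable
  simp_rw [hzero, lintegral_zero] at hswap
  exact hswap.symm

end Packing

/-! ### Exponential integrals over one and two intervals. -/

lemma freqExp_zero_freq (x : ℝ) : freqExp 0 x = 1 := by simp [freqExp]

lemma freqExp_eq_one_iff {ν x : ℝ} : freqExp ν x = 1 ↔ ∃ k : ℤ, x * ν = k := by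
  rw [freqExp, Complex.exp_eq_one_iff]
  refine exists_congr fun k => ?_
  have h2 : (2 * Real.pi * Complex.I : ℂ) ≠ 0 := Complex.two_pi_I_ne_zero
  rw [mul_comm (k : ℂ), mul_right_inj' h2]
  norm_cast

lemma freqExp_eq_neg_one_iff {ν x : ℝ} : freqExp ν x = -1 ↔ ∃ k : ℤ, x * ν = k + 1 / 2 := by
  have h1 : freqExp 1 (1 / 2) = -1 := by
    rw [freqExp, ← Complex.exp_pi_mul_I]
    congr 1
    push_cast
    ring
  have h2 : freqExp ν x = -1 ↔ freqExp 1 (x * ν + 1 / 2) = 1 := by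
    rw [freqExp_add, h1, mul_neg_one, neg_eq_iff_eq_neg]
    simp [freqExp]
  rw [h2, freqExp_eq_one_iff]
  constructor
  · rintro ⟨k, hk⟩
    exact ⟨k - 1, by push_cast; linarith⟩
  · rintro ⟨k, hk⟩
    exact ⟨k + 1, by push_cast; linarith⟩

lemma half_le_abs_int_add_half (k : ℤ) : (1 / 2 : ℝ) ≤ |(k : ℝ) + 1 / 2| := by
  rcases le_or_gt 0 k with hk | hk
  · have : (0 : ℝ) ≤ k := by exact_mod_cast hk
    exact (by linarith : (1 / 2 : ℝ) ≤ k + 1 / 2).trans (le_abs_self _)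
  · have : (k : ℝ) ≤ -1 := by exact_mod_cast (by omega : k ≤ -1)
    exact (by linarith : (1 / 2 : ℝ) ≤ -(k + 1 / 2)).trans (neg_le_abs _)

lemma setIntegral_Ico_freqExp {a b : ℝ} (hab : a ≤ b) {ν : ℝ} (hν : ν ≠ 0) :
    ∫ x in Set.Ico a b, freqExp ν x
      = freqExp ν ((a + b) / 2) * ((Real.sin (Real.pi * ν * (b - a)) / (Real.pi * ν) : ℝ) : ℂ) := by
  have hc : (2 * Real.pi * Complex.I * ν : ℂ) ≠ 0 :=
    mul_ne_zero Complex.two_pi_I_ne_zero (by exact_mod_cast hν)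
  have h1 : ∀ x : ℝ, freqExp ν x = Complex.exp (2 * Real.pi * Complex.I * ν * x) := by
    intro x
    rw [freqExp]
    congr 1
    push_cast
    ring
  rw [integral_Ico_eq_integral_Ioc, ← intervalIntegral.integral_of_le hab]
  simp_rw [h1]
  rw [integral_exp_mul_complex hc]
  have hb : (2 * Real.pi * Complex.I * ν * b : ℂ) = 2 * Real.pi * Complex.I * ν * ((a + b) / 2 : ℝ)
      + (Real.pi * ν * (b - a) : ℝ) * Complex.I := by
    push_cast
    ring
  have ha : (2 * Real.pi * Complex.I * ν * a : ℂ) = 2 * Real.pi * Complex.I * ν * ((a + b) / 2 : ℝ)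
      + (-(Real.pi * ν * (b - a)) : ℝ) * Complex.I := by
    push_cast
    ring
  rw [hb, ha, Complex.exp_add, Complex.exp_add, Complex.exp_mul_I, Complex.exp_mul_I]
  have hpi : (Real.pi : ℂ) ≠ 0 := by exact_mod_cast Real.pi_ne_zero
  have hν' : (ν : ℂ) ≠ 0 := by exact_mod_cast hν
  push_cast
  rw [Complex.cos_neg, Complex.sin_neg]
  field_simp
  ring

lemma setIntegral_Ico_freqExp_zero {a b : ℝ} (hab : a ≤ b) :
    ∫ x in Set.Ico a b, freqExp 0 x = ((b - a : ℝ) : ℂ) := by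
  simp [freqExp_zero_freq, Measure.real, hab]

lemma setIntegral_Ico_freqExp_ne_zero {a b ν : ℝ} (hab : a < b) (h : |ν| * (b - a) < 1) :
    ∫ x in Set.Ico a b, freqExp ν x ≠ 0 := by
  rcases eq_or_ne ν 0 with rfl | hν
  · rw [setIntegral_Ico_freqExp_zero hab.le]
    exact_mod_cast (sub_pos.2 hab).ne'
  · rw [setIntegral_Ico_freqExp hab.le hν]
    refine mul_ne_zero (freqExp_ne_zero _ _) ?_
    have hpos : 0 < Real.sin (Real.pi * |ν| * (b - a)) := by
      have := abs_pos.2 hν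
      have := sub_pos.2 hab
      have := Real.pi_pos
      refine Real.sin_pos_of_pos_of_lt_pi (by positivity) ?_
      rw [mul_assoc]
      nlinarith
    have hs : Real.sin (Real.pi * ν * (b - a)) ≠ 0 := by
      rcases abs_choice ν with h' | h' <;> rw [h'] at hpos
      · exact hpos.ne'
      · intro h0
        rw [mul_neg, neg_mul, Real.sin_neg, h0] at hpos
        simp at hpos
    exact_mod_cast div_ne_zero hs (mul_ne_zero Real.pi_ne_zero hν)

lemma setIntegral_Ico_freqExp_add (a b c ν : ℝ) :
    ∫ x in Set.Ico (a + c) (b + c), freqExp ν x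
      = freqExp ν c * ∫ x in Set.Ico a b, freqExp ν x := by
  rw [← integral_indicator measurableSet_Ico, ← integral_indicator measurableSet_Ico,
    ← integral_const_mul, ← integral_add_right_eq_self _ c]
  congr 1 with x
  simp only [Set.indicator, Set.mem_Ico, add_le_add_iff_right, add_lt_add_iff_right, freqExp_add]
  split_ifs <;> ring

lemma abs_sin_pi_mul_eq {ν ℓ : ℝ} (hℓ : 0 ≤ ℓ) (h : |ν| * ℓ ≤ 1) :
    |Real.sin (Real.pi * ν * ℓ)| = Real.sin (Real.pi * |ν| * ℓ) := by
  have hnn : 0 ≤ Real.sin (Real.pi * |ν| * ℓ) := by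
    have := Real.pi_pos
    refine Real.sin_nonneg_of_nonneg_of_le_pi (by positivity) ?_
    rw [mul_assoc]
    nlinarith
  rw [← abs_of_nonneg hnn]
  rcases abs_choice ν with h' | h' <;> rw [h']
  rw [mul_neg, neg_mul, Real.sin_neg, abs_neg]

/-- The exponential integrals over two short intervals cancel only if the intervals have
the same length and are half a period apart. -/
lemma setIntegral_two_Ico_freqExp_eq_zero {a₁ b₁ a₂ b₂ ν : ℝ} (h₁ : a₁ < b₁) (h₂ : a₂ < b₂)
    (h : |ν| * ((b₁ - a₁) + (b₂ - a₂)) < 1)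
    (h0 : (∫ x in Set.Ico a₁ b₁, freqExp ν x) + ∫ x in Set.Ico a₂ b₂, freqExp ν x = 0) :
    b₁ - a₁ = b₂ - a₂ ∧ ∃ k : ℤ, (a₂ - a₁) * ν = k + 1 / 2 := by
  have hℓ₁ := sub_pos.2 h₁
  have hℓ₂ := sub_pos.2 h₂
  have hpi := Real.pi_pos
  rcases eq_or_ne ν 0 with rfl | hν
  · rw [setIntegral_Ico_freqExp_zero h₁.le, setIntegral_Ico_freqExp_zero h₂.le] at h0
    have : (b₁ - a₁) + (b₂ - a₂) = 0 := by exact_mod_cast h0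
    linarith
  have hνpos := abs_pos.2 hν
  have hp₁ : 0 < |ν| * (b₁ - a₁) := by positivity
  have hp₂ : 0 < |ν| * (b₂ - a₂) := by positivity
  rw [mul_add] at h
  have hlen : b₁ - a₁ = b₂ - a₂ := by
    have hn := congrArg norm (eq_neg_of_add_eq_zero_left h0)
    rw [norm_neg, setIntegral_Ico_freqExp h₁.le hν, setIntegral_Ico_freqExp h₂.le hν, norm_mul,
      norm_mul, norm_freqExp, norm_freqExp, one_mul, one_mul, Complex.norm_real, Complex.norm_real,
      norm_div, norm_div, div_left_inj' (by simp [hν, Real.pi_ne_zero]), Real.norm_eq_abs,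
      Real.norm_eq_abs, abs_sin_pi_mul_eq hℓ₁.le (by linarith),
      abs_sin_pi_mul_eq hℓ₂.le (by linarith), ← sub_eq_zero, Real.sin_sub_sin] at hn
    -- The half-sum of the two sine arguments is below π/2, so the cosine factor is positive and the
    -- sine factor must vanish.
    rcases mul_eq_zero.1 hn with hs | hs
    · have hs' : Real.sin ((Real.pi * |ν| * (b₁ - a₁) - Real.pi * |ν| * (b₂ - a₂)) / 2) = 0 := by
        simpa using hs
      rw [Real.sin_eq_zero_iff_of_lt_of_lt (by nlinarith) (by nlinarith)] at hs'
      have : Real.pi * |ν| * ((b₁ - a₁) - (b₂ - a₂)) = 0 := by linarith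
      have h3 := (mul_eq_zero.1 this).resolve_left (by positivity)
      linarith
    · exact absurd hs (Real.cos_pos_of_mem_Ioo ⟨by nlinarith, by nlinarith⟩).ne'
  refine ⟨hlen, ?_⟩
  rw [← freqExp_eq_neg_one_iff]
  have hshift := setIntegral_Ico_freqExp_add a₁ b₁ (a₂ - a₁) ν
  rw [add_sub_cancel, show b₁ + (a₂ - a₁) = b₂ by linarith] at hshift
  rw [hshift, ← one_add_mul] at h0
  have hne := setIntegral_Ico_freqExp_ne_zero h₁ (by linarith : |ν| * (b₁ - a₁) < 1)
  have := (mul_eq_zero.1 h0).resolve_right hne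
  linear_combination this

/-- Centring the phase at c makes endpoints symmetric about c contribute equal cosines. The factor
2πν lets the formula include ν = 0. -/
lemma im_freqExp_mul_setIntegral_Ico {a b : ℝ} (hab : a ≤ b) (c ν : ℝ) :
    (2 * Real.pi * ν) * (freqExp ν (-c) * ∫ x in Set.Ico a b, freqExp ν x).im
      = Real.cos (2 * Real.pi * ν * (a - c)) - Real.cos (2 * Real.pi * ν * (b - c)) := by
  rcases eq_or_ne ν 0 with rfl | hν
  · simp
  rw [setIntegral_Ico_freqExp hab hν, ← mul_assoc, ← freqExp_add, Complex.im_mul_ofReal,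
    Real.cos_sub_cos]
  have hsin : (freqExp ν (-c + (a + b) / 2)).im
      = Real.sin ((2 * Real.pi * ν * (a - c) + 2 * Real.pi * ν * (b - c)) / 2) := by
    rw [freqExp, show (2 * Real.pi * Complex.I * ((-c + (a + b) / 2) * ν : ℝ) : ℂ)
      = ((2 * Real.pi * ν * (a - c) + 2 * Real.pi * ν * (b - c)) / 2 : ℝ) * Complex.I by
        push_cast; ring]
    exact Complex.exp_ofReal_mul_I_im _
  rw [hsin, show (2 * Real.pi * ν * (a - c) - 2 * Real.pi * ν * (b - c)) / 2
    = -(Real.pi * ν * (b - a)) by ring, Real.sin_neg]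
  have := Real.pi_ne_zero
  field_simp

lemma setIntegral_union_Ico_freqExp {a b c d : ℝ} (h : b ≤ c) (ν : ℝ) :
    ∫ x in Set.Ico a b ∪ Set.Ico c d, freqExp ν x
      = (∫ x in Set.Ico a b, freqExp ν x) + ∫ x in Set.Ico c d, freqExp ν x := by
  have hi : ∀ a b, IntegrableOn (freqExp ν) (Set.Ico a b) := fun a b =>
    ((continuous_freqExp ν).integrableOn_Icc).mono_set Set.Ico_subset_Icc_self
  refine setIntegral_union ?_ measurableSet_Ico (hi _ _) (hi _ _)
  rw [Set.disjoint_left]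
  exact fun x hx hy => absurd (hx.2.trans_le h) (not_lt.2 hy.1)

/-! ### Zeros of the ambiguity function of two intervals. -/

section Overlap

variable {α β t : ℝ}

lemma overlap_of_lt_of_le (h0 : 0 ≤ t) (hα : t < α) (hβ : t ≤ β) :
    overlap (twoIntervals α β) t = Set.Ico t α ∪ Set.Ico (α + β + t) (1 + β) := by
  ext x
  simp only [overlap, twoIntervals, Set.mem_inter_iff, Set.mem_union, Set.mem_Ico,
    Set.mem_preimage]
  grind

lemma overlap_of_lt_of_lt (h0 : 0 < β) (hα : t < α) (hβ : β < t) (hα' : α < 1 / 2) :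
    overlap (twoIntervals α β) t
      = (Set.Ico t α ∪ Set.Ico (α + β) (t + α)) ∪ Set.Ico (α + β + t) (1 + β) := by
  ext x
  simp only [overlap, twoIntervals, Set.mem_inter_iff, Set.mem_union, Set.mem_Ico,
    Set.mem_preimage]
  grind

lemma overlap_of_ge_of_le (h0 : 0 ≤ t) (hα : α ≤ t) (hβ : t ≤ β) :
    overlap (twoIntervals α β) t = Set.Ico (α + β + t) (1 + β) := by
  ext x
  simp only [overlap, twoIntervals, Set.mem_inter_iff, Set.mem_union, Set.mem_Ico,
    Set.mem_preimage]
  grind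

lemma overlap_of_ge_of_lt (h0 : 0 < β) (hα : α ≤ t) (hβ : β < t) (ht : t < 1 - α) :
    overlap (twoIntervals α β) t
      = Set.Ico (max (α + β) t) (t + α) ∪ Set.Ico (α + β + t) (1 + β) := by
  ext x
  simp only [overlap, twoIntervals, Set.mem_inter_iff, Set.mem_union, Set.mem_Ico,
    Set.mem_preimage, max_le_iff]
  grind

lemma overlap_of_ge_of_ge (h0 : 0 < β) (hα : α ≤ t) (hβ : β < t) (ht : 1 - α ≤ t) :
    overlap (twoIntervals α β) t = Set.Ico (max (α + β) t) (min (1 + β) (t + α)) := by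
  ext x
  simp only [overlap, twoIntervals, Set.mem_inter_iff, Set.mem_union, Set.mem_Ico,
    Set.mem_preimage, max_le_iff, lt_min_iff]
  grind

variable {μ : ℝ}

/-- The overlap consists of three intervals. About c = α + (β + t)/2 the four inner endpoints are
symmetric in pairs and cancel in the imaginary part, leaving an equality of cosines at t and 1 + β.
It makes μ(1 + β - t) or μ(1 - 2α) an integer. Both multipliers lie in (0, 1), so μ = 0, where the
integral is a positive length. -/
lemma ambiguity_ne_zero_of_three (h0 : 0 < β) (hα : t < α) (hβ : β < t) (hα' : α < 1 / 2)
    (hμ : |μ| < 1) : ambiguity (twoIntervals α β) (t, μ) ≠ 0 := by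
  intro hz
  simp only [ambiguity] at hz
  rw [overlap_of_lt_of_lt h0 hα hβ hα'] at hz
  have hi : ∀ a b, IntegrableOn (freqExp μ) (Set.Ico a b) := fun a b =>
    ((continuous_freqExp μ).integrableOn_Icc).mono_set Set.Ico_subset_Icc_self
  rw [setIntegral_union _ measurableSet_Ico ((hi _ _).union (hi _ _)) (hi _ _),
    setIntegral_union_Ico_freqExp (by linarith)] at hz
  swap
  · rw [Set.disjoint_left]
    rintro x (hx | hx) hy
    · linarith [hx.2, hy.1]
    · linarith [hx.2, hy.1]
  have him := congrArg Complex.im (congrArg (freqExp μ (-(α + (β + t) / 2)) * ·) hz)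
  simp only [mul_add, Complex.add_im, mul_zero, Complex.zero_im] at him
  have h1 := im_freqExp_mul_setIntegral_Ico hα.le (α + (β + t) / 2) μ
  have h2 := im_freqExp_mul_setIntegral_Ico (by linarith : α + β ≤ t + α) (α + (β + t) / 2) μ
  have h3 := im_freqExp_mul_setIntegral_Ico (by linarith : α + β + t ≤ 1 + β)
    (α + (β + t) / 2) μ
  have e1 : Real.cos (2 * Real.pi * μ * (α - (α + (β + t) / 2)))
      = Real.cos (2 * Real.pi * μ * (α + β + t - (α + (β + t) / 2))) := by
    rw [← Real.cos_neg]
    ring_nf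
  have e2 : Real.cos (2 * Real.pi * μ * (α + β - (α + (β + t) / 2)))
      = Real.cos (2 * Real.pi * μ * (t + α - (α + (β + t) / 2))) := by
    rw [← Real.cos_neg]
    ring_nf
  have hcos : Real.cos (2 * Real.pi * μ * (t - (α + (β + t) / 2)))
      = Real.cos (2 * Real.pi * μ * (1 + β - (α + (β + t) / 2))) := by
    linear_combination (2 * Real.pi * μ) * him - h1 - h2 - h3 + e1 - e2
  have hzero : ∀ c : ℝ, 0 < c → c < 1 → ∀ k : ℤ, μ * c = k → μ = 0 := by
    intro c hc0 hc1 k hk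
    have hk1 : |(k : ℝ)| < 1 := by
      rw [← hk, abs_mul, abs_of_pos hc0]
      have := abs_nonneg μ
      nlinarith
    have hk0 : k = 0 := by
      rw [← Int.cast_abs] at hk1
      exact Int.abs_lt_one_iff.1 (by exact_mod_cast hk1)
    rw [hk0, Int.cast_zero] at hk
    exact (mul_eq_zero.1 hk).resolve_right hc0.ne'
  have hμ0 : μ = 0 := by
    have hpi : (2 * Real.pi) ≠ 0 := by positivity
    obtain ⟨k, hk | hk⟩ := Real.cos_eq_cos_iff.1 hcos
    · refine hzero (1 + β - t) (by linarith) (by linarith) k ?_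
      apply mul_left_cancel₀ hpi
      linear_combination hk
    · refine hzero (1 - 2 * α) (by linarith) (by linarith) k ?_
      apply mul_left_cancel₀ hpi
      linear_combination hk
  subst hμ0
  rw [setIntegral_Ico_freqExp_zero hα.le, setIntegral_Ico_freqExp_zero (by linarith),
    setIntegral_Ico_freqExp_zero (by linarith)] at hz
  have : (α - t) + (t + α - (α + β)) + (1 + β - (α + β + t)) = 0 := by exact_mod_cast hz
  linarith

lemma abs_mul_lt_one {ν ℓ : ℝ} (hν : |ν| < 1) (h1 : ℓ ≤ 1) : |ν| * ℓ < 1 := by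
  have := abs_nonneg ν
  nlinarith

/-- The overlap consists of two intervals, of lengths α - t and 1 - α - t. These differ when α <
1/2, so the integrals cannot cancel. -/
lemma ambiguity_ne_zero_of_lt_of_le (h0 : 0 ≤ t) (hα : t < α) (hβ : t ≤ β) (hα' : α < 1 / 2)
    (hμ : |μ| < 1) : ambiguity (twoIntervals α β) (t, μ) ≠ 0 := by
  intro hz
  simp only [ambiguity] at hz
  rw [overlap_of_lt_of_le h0 hα hβ, setIntegral_union_Ico_freqExp (by linarith)] at hz
  have := (setIntegral_two_Ico_freqExp_eq_zero hα (by linarith)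
    (abs_mul_lt_one hμ (by linarith)) hz).1
  linarith

/-- The overlap is a single nonempty interval of length at most α. -/
lemma ambiguity_ne_zero_of_middle (hα0 : 0 < α) (h0 : 0 < β) (hα : α ≤ t) (hβ : β < t)
    (ht : 1 - α ≤ t) (ht' : t < 1 + β) (hα1 : α < 1) (hμ : |μ| * α < 1) :
    ambiguity (twoIntervals α β) (t, μ) ≠ 0 := by
  simp only [ambiguity]
  rw [overlap_of_ge_of_ge h0 hα hβ ht]
  refine setIntegral_Ico_freqExp_ne_zero ?_ (lt_of_le_of_lt ?_ hμ)
  · rw [max_lt_iff, lt_min_iff, lt_min_iff]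
    exact ⟨⟨by linarith, by linarith⟩, by linarith, by linarith⟩
  · refine mul_le_mul_of_nonneg_left ?_ (abs_nonneg _)
    linarith [min_le_right (1 + β) (t + α), le_max_right (α + β) t]

/-- For a long gap, low frequency orthogonality forces disjoint supports. -/
lemma overlap_eq_empty_of_ambiguity_eq_zero (hα0 : 0 < α) (hα : α < 1 / 2) (hβ : 1 - α ≤ β)
    (h0 : 0 ≤ t) (hμ : |μ| < 1) (hz : ambiguity (twoIntervals α β) (t, μ) = 0) :
    overlap (twoIntervals α β) t = ∅ := by
  rcases lt_or_ge t α with h1 | h1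
  · exact absurd hz (ambiguity_ne_zero_of_lt_of_le h0 h1 (by linarith) hα hμ)
  rcases le_or_gt t β with h2 | h2
  · rcases lt_or_ge t (1 - α) with h3 | h3
    · simp only [ambiguity] at hz
      rw [overlap_of_ge_of_le h0 h1 h2] at hz
      exact absurd hz (setIntegral_Ico_freqExp_ne_zero (by linarith)
        (abs_mul_lt_one hμ (by linarith)))
    · rw [overlap_of_ge_of_le h0 h1 h2]
      exact Set.Ico_eq_empty (by linarith)
  · rcases lt_or_ge t (1 + β) with h3 | h3
    · exact absurd hz (ambiguity_ne_zero_of_middle hα0 (by linarith) h1 h2 (by linarith) h3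
        (by linarith) (abs_mul_lt_one hμ (by linarith)))
    · rw [overlap_of_ge_of_ge (by linarith) h1 h2 (by linarith)]
      refine Set.Ico_eq_empty ?_
      have := min_le_left (1 + β) (t + α)
      have := le_max_right (α + β) t
      linarith

/-- For a short gap, orthogonality of overlapping windows forces a frequency separation. -/
lemma one_le_abs_of_ambiguity_eq_zero (hα0 : 0 < α) (hα : α < 1 / 2) (hβ0 : 0 < β)
    (hβ : β < 1 - α) (h0 : 0 ≤ t) (ht : t < 1 + β)
    (hz : ambiguity (twoIntervals α β) (t, μ) = 0) : 1 ≤ |μ| ∨ 1 ≤ |μ| * (1 - α + β) := by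
  by_contra! hcon
  obtain ⟨hμ, hμ'⟩ := hcon
  rcases lt_or_ge t α with h1 | h1
  · rcases le_or_gt t β with h2 | h2
    · exact ambiguity_ne_zero_of_lt_of_le h0 h1 h2 hα hμ hz
    · exact ambiguity_ne_zero_of_three hβ0 h1 h2 hα hμ hz
  rcases le_or_gt t β with h2 | h2
  · simp only [ambiguity] at hz
    rw [overlap_of_ge_of_le h0 h1 h2] at hz
    exact setIntegral_Ico_freqExp_ne_zero (by linarith) (abs_mul_lt_one hμ (by linarith)) hz
  rcases lt_or_ge t (1 - α) with h3 | h3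
  · simp only [ambiguity] at hz
    rw [overlap_of_ge_of_lt hβ0 h1 h2 h3, setIntegral_union_Ico_freqExp (by linarith)] at hz
    have hm1 := le_max_left (α + β) t
    have hm2 := le_max_right (α + β) t
    obtain ⟨hlen, k, hk⟩ := setIntegral_two_Ico_freqExp_eq_zero
      (max_lt (by linarith) (by linarith)) (by linarith)
      (abs_mul_lt_one hμ (by linarith)) hz
    -- This is the distance between the left endpoints, equal to t or α + β. Equality of lengths
    -- gives 2t = 1 - α + β in the first case, and t = 1 - 2α with α + β < t in the second. The
    -- distance is an odd number of half-periods, which bounds |μ| below.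
    have hsep : 0 ≤ α + β + t - max (α + β) t ∧
        2 * (α + β + t - max (α + β) t) ≤ 1 - α + β := by
      rcases max_cases (α + β) t with ⟨h, h'⟩ | ⟨h, h'⟩ <;> rw [h] at hlen ⊢ <;>
        constructor <;> linarith
    have hk' := half_le_abs_int_add_half k
    rw [← hk, abs_mul, abs_of_nonneg hsep.1] at hk'
    have := abs_nonneg μ
    nlinarith
  · exact ambiguity_ne_zero_of_middle hα0 hβ0 h1 h2 h3 ht (by linarith)
      (abs_mul_lt_one hμ (by linarith)) hz

/-- For t < 1/2 the overlap is [t, 1/2) and its translate by β + 1/2, so the integral has the factor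
1 + e^{2πi(β + 1/2)μ}; the other factor is nonzero because |μ| < 2. -/
lemma overlap_eq_empty_or_of_ambiguity_eq_zero_half (hβ : 1 / 2 ≤ β) (h0 : 0 ≤ t)
    (hμ : |μ| < 2) (hz : ambiguity (twoIntervals (1 / 2) β) (t, μ) = 0) :
    overlap (twoIntervals (1 / 2) β) t = ∅ ∨ ∃ k : ℤ, (β + 1 / 2) * μ = k + 1 / 2 := by
  have hμ0 := abs_nonneg μ
  rcases lt_or_ge t (1 / 2) with h1 | h1
  · right
    simp only [ambiguity] at hz
    rw [overlap_of_lt_of_le h0 h1 (by linarith), setIntegral_union_Ico_freqExp (by linarith),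
      show (1 / 2 + β + t : ℝ) = t + (β + 1 / 2) by ring,
      show (1 + β : ℝ) = 1 / 2 + (β + 1 / 2) by ring, setIntegral_Ico_freqExp_add,
      ← one_add_mul] at hz
    have hne := setIntegral_Ico_freqExp_ne_zero h1 (by nlinarith : |μ| * (1 / 2 - t) < 1)
    rw [← freqExp_eq_neg_one_iff]
    linear_combination (mul_eq_zero.1 hz).resolve_right hne
  left
  rcases le_or_gt t β with h2 | h2
  · rw [overlap_of_ge_of_le h0 h1 h2]
    exact Set.Ico_eq_empty (by linarith)
  rcases lt_or_ge t (1 + β) with h3 | h3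
  · exact absurd hz (ambiguity_ne_zero_of_middle (by norm_num) (by linarith) h1 h2 (by linarith) h3
      (by norm_num) (by linarith))
  · rw [overlap_of_ge_of_ge (by linarith) h1 h2 (by linarith)]
    refine Set.Ico_eq_empty ?_
    have := min_le_left (1 + β) (t + 1 / 2)
    have := le_max_right (1 / 2 + β) t
    linarith

end Overlap

/-! ### What a Gabor basis forces on Ω. -/

lemma tilesLine_of_ae_exists {Ω T : Set ℝ}
    (hex : ∀ᵐ x : ℝ, ∃ t ∈ T, x - t ∈ Ω)
    (huniq : ∀ x, ∀ s ∈ T, ∀ t ∈ T, x - s ∈ Ω → x - t ∈ Ω → s = t) : TilesLine Ω := by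
  refine ⟨T, ?_⟩
  filter_upwards [hex] with x hx
  obtain ⟨t, ht, hxt⟩ := hx
  rw [tsum_eq_single ⟨t, ht⟩, Set.indicator_of_mem hxt]
  intro s hs
  exact Set.indicator_of_notMem (fun hxs => hs (Subtype.ext (huniq x s s.2 t ht hxs hxt))) _

lemma measurableSet_twoIntervals (α β : ℝ) : MeasurableSet (twoIntervals α β) :=
  measurableSet_Ico.union measurableSet_Ico

lemma volume_twoIntervals {α β : ℝ} (hα : 0 ≤ α) (hα' : α ≤ 1) (hβ : 0 ≤ β) :
    volume (twoIntervals α β) = 1 := by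
  rw [twoIntervals, measure_union _ measurableSet_Ico, Real.volume_Ico, Real.volume_Ico,
    ← ENNReal.ofReal_add (by linarith) (by linarith)]
  · ring_nf
    exact ENNReal.ofReal_one
  · rw [Set.disjoint_left]
    rintro x ⟨-, h1⟩ ⟨h2, -⟩
    linarith

lemma twoIntervals_subset {α β : ℝ} (hα : 0 ≤ α) (hα' : α ≤ 1) (hβ : 0 ≤ β) :
    twoIntervals α β ⊆ Set.Ioc (-1) (1 + β) := by
  rintro x (⟨h1, h2⟩ | ⟨h1, h2⟩) <;> constructor <;> linarith

/-- Reduces packing to pairs with nonnegative time difference, the case covered by the overlap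
formulas. -/
lemma packing_of_ordered {Λ D : Set (ℝ × ℝ)}
    (h : ∀ p ∈ Λ, ∀ q ∈ Λ, p ≠ q → p.1 ≤ q.1 → ∀ w, w - p ∈ D → w - q ∈ D → False) :
    ∀ p ∈ Λ, ∀ q ∈ Λ, ∀ w, w - p ∈ D → w - q ∈ D → p = q := by
  intro p hp q hq w hwp hwq
  by_contra hne
  rcases le_total p.1 q.1 with hle | hle
  · exact h p hp q hq hne hle w hwp hwq
  · exact h q hq p hp (Ne.symm hne) hle w hwq hwp

/-- Windows at time distance less than 1 + β need frequency separation at least ν₀, so the box [0, 1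
+ β) × [0, ν₀) packs. Its area exceeds 1, since 1 + β is greater than both 1 and 1 - α + β. -/
lemma not_isGaborONB_of_short_gap {α β : ℝ} (hα0 : 0 < α) (hα : α < 1 / 2) (hβ0 : 0 < β)
    (hβ : β < 1 - α) (Λ : Set (ℝ × ℝ)) : ¬ IsGaborONB (charWindow (twoIntervals α β)) Λ := by
  intro h
  have hΩ := measurableSet_twoIntervals α β
  have hc : 0 < 1 - α + β := by linarith
  set ν₀ := min 1 (1 - α + β)⁻¹ with hν₀
  have hpack : ∀ p ∈ Λ, ∀ q ∈ Λ, ∀ w, w - p ∈ Set.Ico 0 (1 + β) ×ˢ Set.Ico 0 ν₀ →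
      w - q ∈ Set.Ico 0 (1 + β) ×ˢ Set.Ico 0 ν₀ → p = q := by
    refine packing_of_ordered fun p hp q hq hne hle w hwp hwq => ?_
    obtain ⟨⟨hp1, hp2⟩, hp3, hp4⟩ := hwp
    obtain ⟨⟨hq1, hq2⟩, hq3, hq4⟩ := hwq
    simp only [Prod.fst_sub, Prod.snd_sub] at hp1 hp2 hp3 hp4 hq1 hq2 hq3 hq4
    have hz := h.ambiguity_eq_zero hΩ hp hq hne
    have hlt : |(q - p).2| < ν₀ := by
      rw [Prod.snd_sub, abs_lt]
      constructor <;> linarith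
    rcases one_le_abs_of_ambiguity_eq_zero (t := (q - p).1) (μ := (q - p).2) hα0 hα hβ0 hβ
      (by simpa using hle) (by rw [Prod.fst_sub]; linarith) hz with h1 | h1
    · linarith [min_le_left 1 (1 - α + β)⁻¹]
    · have h2 : |(q - p).2| < (1 - α + β)⁻¹ := hlt.trans_le (min_le_right _ _)
      rw [← div_le_iff₀ hc, one_div] at h1
      linarith
  have hle := h.volume_packing_le_one hΩ (by linarith : (-1 : ℝ) < 1 + β)
    (twoIntervals_subset hα0.le (by linarith) hβ0.le)
    (volume_twoIntervals hα0.le (by linarith) hβ0.le)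
    (measurableSet_Ico.prod measurableSet_Ico) hpack
  rw [Measure.volume_eq_prod, Measure.prod_prod, Real.volume_Ico, Real.volume_Ico, sub_zero,
    sub_zero, ← ENNReal.ofReal_mul (by linarith), ENNReal.ofReal_le_one] at hle
  have : 1 < (1 + β) * ν₀ := by
    rcases min_cases 1 (1 - α + β)⁻¹ with ⟨h1, -⟩ | ⟨h1, -⟩ <;> rw [hν₀, h1]
    · linarith
    · rw [← div_eq_mul_inv, one_lt_div hc]
      linarith
  linarith

lemma tilesLine_of_isGaborONB_of_long_gap {α β : ℝ} (hα0 : 0 < α) (hα : α < 1 / 2)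
    (hβ : 1 - α ≤ β) {Λ : Set (ℝ × ℝ)} (h : IsGaborONB (charWindow (twoIntervals α β)) Λ) :
    TilesLine (twoIntervals α β) := by
  have hΩ := measurableSet_twoIntervals α β
  have hvol := volume_twoIntervals hα0.le (by linarith : α ≤ 1) (by linarith : 0 ≤ β)
  have hpack : ∀ p ∈ Λ, ∀ q ∈ Λ, ∀ w, w - p ∈ twoIntervals α β ×ˢ Set.Ico 0 1 →
      w - q ∈ twoIntervals α β ×ˢ Set.Ico 0 1 → p = q := by
    refine packing_of_ordered fun p hp q hq hne hle w hwp hwq => ?_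
    obtain ⟨hp1, hp3, hp4⟩ := hwp
    obtain ⟨hq1, hq3, hq4⟩ := hwq
    simp only [Prod.fst_sub, Prod.snd_sub] at hp1 hp3 hp4 hq1 hq3 hq4
    have hlt : |(q - p).2| < 1 := by
      rw [Prod.snd_sub, abs_lt]
      constructor <;> linarith
    have hemp := overlap_eq_empty_of_ambiguity_eq_zero (t := (q - p).1) (μ := (q - p).2) hα0 hα hβ
      (by simpa using hle) hlt (h.ambiguity_eq_zero hΩ hp hq hne)
    have : w.1 - p.1 ∈ overlap (twoIntervals α β) (q - p).1 := by
      refine ⟨hp1, ?_⟩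
      rw [Set.mem_preimage, Prod.fst_sub, sub_sub_sub_cancel_right]
      exact hq1
    rw [hemp] at this
    exact this
  have hae := h.ae_mem_packing hΩ (by linarith : (-1 : ℝ) < 1 + β)
    (twoIntervals_subset hα0.le (by linarith) (by linarith)) hvol
    (hΩ.prod measurableSet_Ico)
    (by rw [Measure.volume_eq_prod, Measure.prod_prod, hvol]; simp) hpack
  -- After swapping coordinates, Fubini gives a fixed frequency y whose horizontal slice of the
  -- tiling covers almost every time.
  have hswap := (Measure.measurePreserving_swap (μ := (volume : Measure ℝ))
    (ν := (volume : Measure ℝ))).quasiMeasurePreserving.ae hae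
  obtain ⟨y, hy⟩ := (Measure.ae_ae_of_ae_prod hswap).exists
  refine tilesLine_of_ae_exists (T := {t | ∃ ν, (t, ν) ∈ Λ ∧ y - ν ∈ Set.Ico (0 : ℝ) 1}) ?_ ?_
  · filter_upwards [hy] with x hx
    obtain ⟨p, hp, h1, h2⟩ := hx
    exact ⟨p.1, ⟨p.2, hp, h2⟩, h1⟩
  · rintro x s ⟨ν, hν, hyν⟩ t ⟨μ, hμ, hyμ⟩ hs ht
    exact congrArg Prod.fst (hpack _ hν _ hμ (x, y) ⟨hs, hyν⟩ ⟨ht, hyμ⟩)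

/-- The frequencies in `[0, 2)` lying in the first half of a period of length `1 / m`. -/
def halfPeriods (m : ℝ) : Set ℝ := Set.Ico 0 2 ∩ {y | Int.fract (m * y) < 1 / 2}

lemma measurableSet_halfPeriods (m : ℝ) : MeasurableSet (halfPeriods m) :=
  measurableSet_Ico.inter
    (measurableSet_lt (measurable_fract.comp (measurable_const_mul m)) measurable_const)

/-- Moving left by half a period 1/(2m) sends the complement of `halfPeriods m` in [0, 2) into
`halfPeriods m`. When 2m is not an integer, [0, 2) ends inside a period, and the image misses a
nontrivial interval `I` lying within half a period of the end. So more than half of [0, 2) is kept.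
-/
lemma one_lt_volume_halfPeriods {m : ℝ} (hm : 1 ≤ m) (hint : Int.fract (2 * m) ≠ 0) :
    1 < volume (halfPeriods m) := by
  have hm0 : 0 < m := by linarith
  have hr0 : 0 < Int.fract (2 * m) := lt_of_le_of_ne (Int.fract_nonneg _) hint.symm
  have hr1 := Int.fract_lt_one (2 * m)
  have hfl := Int.floor_add_fract (2 * m)
  set N := ⌊2 * m⌋ with hN
  set r := Int.fract (2 * m) with hr
  have hG := measurableSet_halfPeriods m
  set G := halfPeriods m with hGdef
  set I : Set ℝ := Set.Ico (max (N : ℝ) (2 * m - 1 / 2) / m) (min (2 * m) (N + 1 / 2) / m) with hI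
  have hIlt : max (N : ℝ) (2 * m - 1 / 2) < min (2 * m) (N + 1 / 2) := by
    rw [max_lt_iff, lt_min_iff, lt_min_iff]
    exact ⟨⟨by linarith, by linarith⟩, by linarith, by linarith⟩
  have hmemI : ∀ y, y ∈ I ↔ (N : ℝ) ≤ m * y ∧ 2 * m - 1 / 2 ≤ m * y ∧ m * y < 2 * m ∧
      m * y < N + 1 / 2 := by
    intro y
    rw [hI, Set.mem_Ico, div_le_iff₀ hm0, lt_div_iff₀ hm0, max_le_iff, lt_min_iff, mul_comm y,
      and_assoc]
  have hIpos : 0 < volume I := by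
    rw [hI, Real.volume_Ico, ENNReal.ofReal_pos, sub_pos]
    exact div_lt_div_of_pos_right hIlt hm0
  have hIG : I ⊆ G := by
    intro y hy
    obtain ⟨h1, h2, h3, h4⟩ := (hmemI y).1 hy
    refine ⟨⟨?_, ?_⟩, ?_⟩
    · by_contra! hneg
      nlinarith
    · by_contra! hneg
      nlinarith
    · have : ⌊m * y⌋ = N := Int.floor_eq_iff.2 ⟨h1, by linarith⟩
      rw [Set.mem_ofPred_eq, Int.fract, this]
      linarith
  have hsub : Set.Ico 0 2 \ G ⊆ (fun y => y - 1 / (2 * m)) ⁻¹' (G \ I) := by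
    rintro y ⟨⟨hy0, hy2⟩, hyG⟩
    have hfr : 1 / 2 ≤ Int.fract (m * y) := by
      by_contra! hlt
      exact hyG ⟨⟨hy0, hy2⟩, hlt⟩
    have hfr1 := Int.fract_lt_one (m * y)
    have hshift : m * (y - 1 / (2 * m)) = m * y - 1 / 2 := by field_simp
    have hfrac : Int.fract (m * (y - 1 / (2 * m))) = Int.fract (m * y) - 1 / 2 := by
      rw [hshift, Int.fract_eq_iff]
      refine ⟨by linarith, by linarith, ⌊m * y⌋, ?_⟩
      linarith [Int.floor_add_fract (m * y)]
    have hmy : 1 / 2 ≤ m * y := by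
      have h1 : (0 : ℝ) ≤ ⌊m * y⌋ := by exact_mod_cast Int.floor_nonneg.2 (by positivity)
      linarith [Int.floor_add_fract (m * y)]
    have hpos : 0 < 1 / (2 * m) := by positivity
    refine ⟨⟨⟨?_, ?_⟩, ?_⟩, ?_⟩
    · by_contra! hneg
      have : m * (y - 1 / (2 * m)) < 0 := mul_neg_of_pos_of_neg hm0 hneg
      linarith
    · change y - 1 / (2 * m) < 2
      linarith
    · rw [Set.mem_ofPred_eq, hfrac]
      linarith
    · intro hyI
      obtain ⟨-, h2, -⟩ := (hmemI _).1 hyI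
      rw [hshift] at h2
      nlinarith
  have hle : volume (Set.Ico 0 2 \ G) ≤ volume (G \ I) := by
    refine (measure_mono hsub).trans_eq ?_
    exact (measurePreserving_sub_right volume (1 / (2 * m))).measure_preimage
      (hG.diff measurableSet_Ico).nullMeasurableSet
  have h2 : volume (Set.Ico (0 : ℝ) 2 \ G) + volume G = 2 := by
    have hGs : G ⊆ Set.Ico 0 2 := Set.inter_subset_left
    have := measure_sdiff_add_inter (μ := volume) (Set.Ico (0 : ℝ) 2) hG
    rw [Set.inter_eq_right.2 hGs, Real.volume_Ico, sub_zero] at this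
    rw [this]
    norm_num
  have hGI : volume (G \ I) + volume I = volume G := by
    have := measure_sdiff_add_inter (μ := volume) G (measurableSet_Ico : MeasurableSet I)
    rwa [Set.inter_eq_right.2 hIG] at this
  by_contra! hcon
  have hfin : volume (G \ I) ≠ ∞ :=
    ((measure_mono Set.sdiff_subset).trans_lt (hcon.trans_lt ENNReal.one_lt_top)).ne
  have hlt : volume (G \ I) < 1 :=
    (ENNReal.lt_add_right hfin hIpos.ne').trans_le (hGI.trans_le hcon)
  have : (2 : ℝ≥0∞) < 1 + 1 := by
    rw [← h2]
    exact ENNReal.add_lt_add_of_lt_of_le (hcon.trans_lt ENNReal.one_lt_top).ne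
      (hle.trans_lt hlt) hcon
  norm_num at this

/-- Two points of `halfPeriods m` never differ by an odd multiple of 1/(2m), the only separation
that lets overlapping windows be orthogonal. So Ω × `halfPeriods m` packs, and its area can be at
most 1 only if 2m is an integer. -/
lemma exists_nat_half_of_isGaborONB_half {β : ℝ} (hβ : 1 / 2 ≤ β) {Λ : Set (ℝ × ℝ)}
    (h : IsGaborONB (charWindow (twoIntervals (1 / 2) β)) Λ) : ∃ n : ℕ, β = n / 2 := by
  have hΩ := measurableSet_twoIntervals (1 / 2) β
  have hvol := volume_twoIntervals (by norm_num : (0 : ℝ) ≤ 1 / 2) (by norm_num)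
    (by linarith : 0 ≤ β)
  set m := β + 1 / 2 with hm
  have hpack : ∀ p ∈ Λ, ∀ q ∈ Λ, ∀ w, w - p ∈ twoIntervals (1 / 2) β ×ˢ halfPeriods m →
      w - q ∈ twoIntervals (1 / 2) β ×ˢ halfPeriods m → p = q := by
    refine packing_of_ordered fun p hp q hq hne hle w hwp hwq => ?_
    obtain ⟨hp1, ⟨hp3, hp4⟩, hp5⟩ := hwp
    obtain ⟨hq1, ⟨hq3, hq4⟩, hq5⟩ := hwq
    simp only [Prod.fst_sub, Prod.snd_sub, Set.mem_ofPred_eq] at hp1 hp3 hp4 hq1 hq3 hq4 hp5 hq5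
    have hlt : |(q - p).2| < 2 := by
      rw [Prod.snd_sub, abs_lt]
      constructor <;> linarith
    rcases overlap_eq_empty_or_of_ambiguity_eq_zero_half (t := (q - p).1) (μ := (q - p).2) hβ
      (by simpa using hle) hlt (h.ambiguity_eq_zero hΩ hp hq hne) with hemp | ⟨k, hk⟩
    · have : w.1 - p.1 ∈ overlap (twoIntervals (1 / 2) β) (q - p).1 := by
        refine ⟨hp1, ?_⟩
        rw [Set.mem_preimage, Prod.fst_sub, sub_sub_sub_cancel_right]
        exact hq1
      rw [hemp] at this
      exact this
    · rw [Prod.snd_sub, ← hm] at hk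
      have h1 := Int.floor_add_fract (m * (w.2 - p.2))
      have h2 := Int.floor_add_fract (m * (w.2 - q.2))
      have h3 := Int.fract_nonneg (m * (w.2 - p.2))
      have h4 := Int.fract_nonneg (m * (w.2 - q.2))
      have h5 := half_le_abs_int_add_half (k - ⌊m * (w.2 - p.2)⌋ + ⌊m * (w.2 - q.2)⌋)
      have h6 : (((k - ⌊m * (w.2 - p.2)⌋ + ⌊m * (w.2 - q.2)⌋ : ℤ) : ℝ) + 1 / 2)
          = Int.fract (m * (w.2 - p.2)) - Int.fract (m * (w.2 - q.2)) := by
        push_cast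
        linear_combination -hk - h1 + h2
      rw [h6] at h5
      have h7 : |Int.fract (m * (w.2 - p.2)) - Int.fract (m * (w.2 - q.2))| < 1 / 2 := by
        rw [abs_lt]
        constructor <;> linarith
      linarith
  have hle := h.volume_packing_le_one hΩ (by linarith : (-1 : ℝ) < 1 + β)
    (twoIntervals_subset (by norm_num) (by norm_num) (by linarith)) hvol
    (hΩ.prod (measurableSet_halfPeriods m)) hpack
  rw [Measure.volume_eq_prod, Measure.prod_prod, hvol, one_mul] at hle
  have hfr : Int.fract (2 * m) = 0 := by
    by_contra hne
    exact absurd hle (not_le.2 (one_lt_volume_halfPeriods (by linarith) hne))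
  have hfl := Int.floor_add_fract (2 * m)
  have hnn : 0 ≤ ⌊2 * m⌋ - 1 := by
    have : (1 : ℤ) ≤ ⌊2 * m⌋ := Int.le_floor.2 (by push_cast; linarith)
    omega
  refine ⟨(⌊2 * m⌋ - 1).toNat, ?_⟩
  have : (((⌊2 * m⌋ - 1).toNat : ℤ) : ℝ) = ⌊2 * m⌋ - 1 := by
    rw [Int.toNat_of_nonneg hnn]
    push_cast
    ring
  rw [← Int.cast_natCast, this]
  linarith

/-! ### Tilings by two intervals determine the gap. -/

/-- Conull sets are dense, and membership in a half-open interval persists to the right; together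
these upgrade almost-everywhere statements to every point. -/
lemma exists_of_ae_of_eventually_nhdsGT {P Q : ℝ → Prop} {x : ℝ}
    (hP : ∀ᵐ y : ℝ, P y) (hQ : ∀ᶠ y in nhdsWithin x (Set.Ioi x), Q y) : ∃ y, P y ∧ Q y := by
  obtain ⟨u, hu, hsub⟩ := mem_nhdsGT_iff_exists_Ioo_subset.1 hQ
  obtain ⟨y, hy, hyP⟩ := (Measure.dense_of_ae hP).exists_mem_open isOpen_Ioo
    (Set.nonempty_Ioo.2 hu)
  exact ⟨y, hy, hsub hyP⟩

lemma eventually_sub_mem_Ico {a b t x : ℝ} (h : x - t ∈ Set.Ico a b) :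
    ∀ᶠ y in nhdsWithin x (Set.Ioi x), y - t ∈ Set.Ico a b := by
  have h1 : x < b + t := by linarith [h.2]
  filter_upwards [Ioo_mem_nhdsGT h1] with y hy
  exact ⟨by linarith [h.1, hy.1], by linarith [hy.2]⟩

lemma eventually_sub_notMem_Ico {a b t x : ℝ} (h : x - t ∉ Set.Ico a b) :
    ∀ᶠ y in nhdsWithin x (Set.Ioi x), y - t ∉ Set.Ico a b := by
  rcases lt_or_ge (x - t) a with h1 | h1
  · have h2 : x < a + t := by linarith
    filter_upwards [Ioo_mem_nhdsGT h2] with y hy hya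
    linarith [hya.1, hy.2]
  · have h2 : b ≤ x - t := not_lt.1 fun h2 => h ⟨h1, h2⟩
    filter_upwards [self_mem_nhdsWithin] with y hy hya
    linarith [hya.2, Set.mem_Ioi.1 hy]

lemma eventually_sub_mem_twoIntervals {α β t x : ℝ} (h : x - t ∈ twoIntervals α β) :
    ∀ᶠ y in nhdsWithin x (Set.Ioi x), y - t ∈ twoIntervals α β := by
  rcases h with h | h
  · exact (eventually_sub_mem_Ico h).mono fun y hy => Or.inl hy
  · exact (eventually_sub_mem_Ico h).mono fun y hy => Or.inr hy

lemma eventually_sub_notMem_twoIntervals {α β t x : ℝ} (h : x - t ∉ twoIntervals α β) :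
    ∀ᶠ y in nhdsWithin x (Set.Ioi x), y - t ∉ twoIntervals α β := by
  rw [twoIntervals, Set.mem_union, not_or] at h
  filter_upwards [eventually_sub_notMem_Ico h.1, eventually_sub_notMem_Ico h.2] with y h1 h2
  rintro (h | h)
  exacts [h1 h, h2 h]

/-- A tiling by half-open intervals is exact: every point is covered exactly once. -/
lemma TilesLine.exists_exact {α β : ℝ} (hα0 : 0 < α) (hα : α ≤ 1 / 2) (hβ : 0 < β)
    (h : TilesLine (twoIntervals α β)) :
    ∃ T : Set ℝ, (∀ x, ∀ s ∈ T, ∀ t ∈ T, x - s ∈ twoIntervals α β → x - t ∈ twoIntervals α β →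
      s = t) ∧ ∀ x, ∃ t ∈ T, x - t ∈ twoIntervals α β := by
  obtain ⟨T, hT⟩ := h
  have huniq : ∀ x, ∀ s ∈ T, ∀ t ∈ T, x - s ∈ twoIntervals α β → x - t ∈ twoIntervals α β →
      s = t := by
    intro x s hs t ht hxs hxt
    by_contra hne
    obtain ⟨y, hy, hys, hyt⟩ := exists_of_ae_of_eventually_nhdsGT hT
      ((eventually_sub_mem_twoIntervals hxs).and (eventually_sub_mem_twoIntervals hxt))
    have hle := ENNReal.sum_le_tsum (f := fun t : T =>
      (twoIntervals α β).indicator (fun _ => (1 : ℝ≥0∞)) (y - t)) {⟨s, hs⟩, ⟨t, ht⟩}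
    rw [hy, Finset.sum_pair (by simpa using hne), Set.indicator_of_mem hys,
      Set.indicator_of_mem hyt] at hle
    norm_num at hle
  -- Closer translates would overlap in their second intervals, of length 1 - α ≥ 1/2. Thus only
  -- finitely many translates matter near x, and all of them avoid a common right neighbourhood of
  -- an uncovered x.
  have hsep : ∀ s ∈ T, ∀ t ∈ T, s < t → 1 / 2 ≤ t - s := by
    intro s hs t ht hst
    by_contra! hlt
    refine hst.ne (huniq (t + α + β) s hs t ht (Or.inr ⟨?_, ?_⟩) (Or.inr ⟨?_, ?_⟩)) <;> linarith
  refine ⟨T, huniq, fun x => ?_⟩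
  by_contra! hcon
  have hfin : (T ∩ Set.Icc (x - 1 - β) (x + 1)).Finite := by
    refine Set.Finite.of_injOn (f := fun t : ℝ => ⌊2 * t⌋)
      (t := Set.Icc ⌊2 * (x - 1 - β)⌋ ⌊2 * (x + 1)⌋) ?_ ?_ (Set.finite_Icc _ _)
    · rintro t ⟨-, h1, h2⟩
      exact ⟨Int.floor_le_floor (by linarith), Int.floor_le_floor (by linarith)⟩
    · rintro s ⟨hs, -⟩ t ⟨ht, -⟩ hst
      have hst' := Int.abs_sub_lt_one_of_floor_eq_floor hst
      rw [abs_lt] at hst'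
      rcases lt_trichotomy s t with h1 | h1 | h1
      · linarith [hsep s hs t ht h1]
      · exact h1
      · linarith [hsep t ht s hs h1]
  have hev : ∀ᶠ y in nhdsWithin x (Set.Ioi x), ∀ t ∈ T ∩ Set.Icc (x - 1 - β) (x + 1),
      y - t ∉ twoIntervals α β :=
    (Filter.eventually_all_finite hfin).2 fun t ht =>
      eventually_sub_notMem_twoIntervals (hcon t ht.1)
  have hnear : ∀ᶠ y in nhdsWithin x (Set.Ioi x), y ∈ Set.Ioo x (x + 1) :=
    Ioo_mem_nhdsGT (by linarith)
  obtain ⟨y, hy, hyT, hyx⟩ := exists_of_ae_of_eventually_nhdsGT hT (hev.and hnear)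
  have hzero : ∑' t : T, (twoIntervals α β).indicator (fun _ => (1 : ℝ≥0∞)) (y - t) = 0 := by
    rw [ENNReal.tsum_eq_zero]
    intro t
    refine Set.indicator_of_notMem (fun hyt => ?_) _
    refine hyT t ⟨t.2, ?_⟩ hyt
    obtain ⟨h1, h2⟩ := hyx
    rcases hyt with ⟨h3, h4⟩ | ⟨h3, h4⟩ <;> constructor <;> linarith
  rw [hzero] at hy
  exact zero_ne_one hy

/-- The gap after [t, t + α) is too short to be followed by another short interval, so a long one
starts at t + α, giving t - β ∈ T. Likewise a short one starts at t + 1 + β, so T is stable under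
adding 1. Then t - β + ⌈β⌉ lies in T ∩ [t, t + 1), and separation by 1 - α > 1/2 forces it to be t.
-/
lemma TilesLine.exists_nat {α β : ℝ} (hα0 : 0 < α) (hα : α < 1 / 2) (hβ : 0 < β)
    (h : TilesLine (twoIntervals α β)) : ∃ n : ℕ, β = n := by
  obtain ⟨T, huniq, hcov⟩ := h.exists_exact hα0 hα.le hβ
  have hsep : ∀ s ∈ T, ∀ t ∈ T, s < t → 1 - α ≤ t - s := by
    intro s hs t ht hst
    by_contra! hlt
    refine hst.ne (huniq (t + α + β) s hs t ht (Or.inr ⟨?_, ?_⟩) (Or.inr ⟨?_, ?_⟩)) <;> linarith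
  have hprev : ∀ t ∈ T, t - β ∈ T := by
    intro t ht
    obtain ⟨s, hs, ⟨h1, h2⟩ | ⟨h1, h2⟩⟩ := hcov (t + α)
    · linarith [hsep t ht s hs (by linarith)]
    · rcases h1.eq_or_lt with h3 | h3
      · rwa [show t - β = s by linarith]
      · have : s = t := by
          rcases le_total t (s + α + β) with h4 | h4
          · exact huniq (s + α + β) s hs t ht (Or.inr ⟨by linarith, by linarith⟩)
              (Or.inl ⟨by linarith, by linarith⟩)
          · exact huniq t s hs t ht (Or.inr ⟨by linarith, by linarith⟩)
              (Or.inl ⟨by linarith, by linarith⟩)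
        linarith
  have hnext : ∀ t ∈ T, t + 1 + β ∈ T := by
    intro t ht
    obtain ⟨s, hs, ⟨h1, h2⟩ | ⟨h1, h2⟩⟩ := hcov (t + 1 + β)
    · rcases h1.eq_or_lt with h3 | h3
      · rwa [show t + 1 + β = s by linarith]
      · have : s = t := by
          rcases le_total s (t + α + β) with h4 | h4
          · exact huniq (t + α + β) s hs t ht (Or.inl ⟨by linarith, by linarith⟩)
              (Or.inr ⟨by linarith, by linarith⟩)
          · exact huniq s s hs t ht (Or.inl ⟨by linarith, by linarith⟩)
              (Or.inr ⟨by linarith, by linarith⟩)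
        linarith
    · have h3 := hsep t ht s hs (by linarith)
      have := huniq s s hs (t - β) (hprev t ht) (Or.inl ⟨by linarith, by linarith⟩)
        (Or.inr ⟨by linarith, by linarith⟩)
      linarith
  have hsucc : ∀ t ∈ T, t + 1 ∈ T := by
    intro t ht
    have := hprev _ (hnext t ht)
    rwa [add_sub_cancel_right] at this
  have hadd : ∀ n : ℕ, ∀ t ∈ T, t + n ∈ T := by
    intro n t ht
    induction n with
    | zero => simpa using ht
    | succ k ih =>
      have := hsucc _ ih
      push_cast
      rwa [← add_assoc]
  obtain ⟨t, ht, -⟩ := hcov 0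
  have hceil := Nat.le_ceil β
  have hceil' := Nat.ceil_lt_add_one hβ.le
  have h1 := hadd ⌈β⌉₊ _ (hprev t ht)
  refine ⟨⌈β⌉₊, hceil.antisymm (not_lt.1 fun hlt => ?_)⟩
  have h2 := hsep t ht _ h1 (by linarith)
  have h3 := hsep _ h1 _ (hsucc t ht) (by linarith)
  linarith

/-- With equal pieces the line is tiled by intervals of length 1/2, with left endpoints in T or T +
1/2 + β. These endpoints advance in steps of exactly 1/2, so 1/2 + β is a multiple of 1/2. -/
lemma TilesLine.exists_nat_half {β : ℝ} (hβ : 0 < β)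
    (h : TilesLine (twoIntervals (1 / 2) β)) : ∃ n : ℕ, β = n / 2 := by
  obtain ⟨T, huniq, hcov⟩ := h.exists_exact (by norm_num) le_rfl hβ
  have hdisj : ∀ p q, (p ∈ T ∨ p - (1 / 2 + β) ∈ T) → (q ∈ T ∨ q - (1 / 2 + β) ∈ T) →
      p ≤ q → q < p + 1 / 2 → p = q := by
    rintro p q (hp | hp) (hq | hq) h1 h2
    · exact huniq q p hp q hq (Or.inl ⟨by linarith, by linarith⟩)
        (Or.inl ⟨by linarith, by linarith⟩)
    · have := huniq q p hp _ hq (Or.inl ⟨by linarith, by linarith⟩)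
        (Or.inr ⟨by linarith, by linarith⟩)
      linarith
    · have := huniq q _ hp q hq (Or.inr ⟨by linarith, by linarith⟩)
        (Or.inl ⟨by linarith, by linarith⟩)
      linarith
    · have := huniq q _ hp _ hq (Or.inr ⟨by linarith, by linarith⟩)
        (Or.inr ⟨by linarith, by linarith⟩)
      linarith
  have hstep : ∀ p, (p ∈ T ∨ p - (1 / 2 + β) ∈ T) →
      (p + 1 / 2 ∈ T ∨ p + 1 / 2 - (1 / 2 + β) ∈ T) := by
    intro p hp
    obtain ⟨q, hq, h1, h2⟩ : ∃ q, (q ∈ T ∨ q - (1 / 2 + β) ∈ T) ∧ q ≤ p + 1 / 2 ∧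
        p + 1 / 2 < q + 1 / 2 := by
      obtain ⟨s, hs, ⟨h1, h2⟩ | ⟨h1, h2⟩⟩ := hcov (p + 1 / 2)
      · exact ⟨s, Or.inl hs, by linarith, by linarith⟩
      · exact ⟨s + (1 / 2 + β), Or.inr (by rwa [add_sub_cancel_right]), by linarith, by linarith⟩
    rcases h1.eq_or_lt with h3 | h3
    · rwa [← h3]
    · linarith [hdisj p q hp hq (by linarith) h3]
  have hadd : ∀ n : ℕ, ∀ p, (p ∈ T ∨ p - (1 / 2 + β) ∈ T) →
      (p + n / 2 ∈ T ∨ p + n / 2 - (1 / 2 + β) ∈ T) := by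
    intro n p hp
    induction n with
    | zero => simpa using hp
    | succ k ih =>
      have := hstep _ ih
      rwa [show p + ((k + 1 : ℕ) : ℝ) / 2 = p + k / 2 + 1 / 2 by push_cast; ring]
  obtain ⟨t, ht, -⟩ := hcov 0
  have hfl := Nat.floor_le (by positivity : 0 ≤ 2 * β)
  have hfl' := Nat.lt_floor_add_one (2 * β)
  have := hdisj _ (t + (1 / 2 + β)) (hadd (⌊2 * β⌋₊ + 1) t (Or.inl ht))
    (Or.inr (by rwa [add_sub_cancel_right])) (by push_cast; linarith) (by push_cast; linarith)
  refine ⟨⌊2 * β⌋₊, ?_⟩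
  push_cast at this
  linarith

/-! ### Gabor bases from a tiling and a spectrum. -/

lemma ae_sub_right {P : ℝ → Prop} (h : ∀ᵐ x : ℝ, P x) (c : ℝ) : ∀ᵐ x : ℝ, P (x - c) :=
  (measurePreserving_sub_right volume c).quasiMeasurePreserving.ae h

lemma memLp_freqExp_mul {f : ℝ → ℂ} (hf : MemLp f 2 volume) (ν : ℝ) :
    MemLp (fun x => freqExp ν x * f x) 2 volume :=
  hf.of_le ((continuous_freqExp ν).aestronglyMeasurable.mul hf.1)
    (Filter.Eventually.of_forall fun x => by rw [norm_mul, norm_freqExp, one_mul])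

lemma integrableOn_Ico_of_memLp {f : ℝ → ℂ} (hf : MemLp f 2 volume) (a b : ℝ) :
    IntegrableOn f (Set.Ico a b) :=
  (hf.restrict _).integrable (by norm_num)

lemma memLp_comp_add {f : ℝ → ℂ} (hf : MemLp f 2 volume) (c : ℝ) :
    MemLp (fun x => f (x + c)) 2 volume :=
  hf.comp_measurePreserving (measurePreserving_add_right volume c)

lemma setIntegral_Ico_add {f : ℝ → ℂ} (a b c : ℝ) :
    ∫ x in Set.Ico (a + c) (b + c), f x = ∫ x in Set.Ico a b, f (x + c) := by
  rw [← integral_indicator measurableSet_Ico, ← integral_indicator measurableSet_Ico,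
    ← integral_add_right_eq_self _ c]
  congr 1 with x
  simp only [Set.indicator, Set.mem_Ico, add_le_add_iff_right, add_lt_add_iff_right]

lemma setIntegral_twoIntervals {α β : ℝ} (hβ : 0 ≤ β) {f : ℝ → ℂ} (hf : MemLp f 2 volume) :
    ∫ x in twoIntervals α β, f x
      = (∫ x in Set.Ico 0 α, f x) + ∫ x in Set.Ico α 1, f (x + β) := by
  rw [twoIntervals, setIntegral_union _ measurableSet_Ico (integrableOn_Ico_of_memLp hf _ _)
    (integrableOn_Ico_of_memLp hf _ _), setIntegral_Ico_add]
  rw [Set.disjoint_left]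
  rintro x ⟨-, h1⟩ ⟨h2, -⟩
  linarith

/-- An `L²` function whose Fourier coefficients on an interval vanish is zero there. -/
lemma ae_eq_zero_of_fourier_eq_zero {f : ℝ → ℂ} (hf : MemLp f 2 volume) {a P : ℝ} (hP : 0 < P)
    (h : ∀ k : ℤ, ∫ x in Set.Ico a (a + P), freqExp (-(k / P)) x * f x = 0) :
    ∀ᵐ x : ℝ, x ∈ Set.Ico a (a + P) → f x = 0 := by
  have hab : a < a + P := by linarith
  have hs := hasSum_sq_fourierCoeffOn hab (hf.restrict _)
  have hcoef : ∀ k : ℤ, fourierCoeffOn hab f k = 0 := by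
    intro k
    rw [fourierCoeffOn_eq_integral, intervalIntegral.integral_of_le hab.le,
      ← integral_Ico_eq_integral_Ioc]
    have : ∀ x : ℝ, fourier (-k) (x : AddCircle (a + P - a)) • f x
        = freqExp (-(k / P)) x * f x := by
      intro x
      rw [fourier_coe_apply, smul_eq_mul, freqExp]
      congr 2
      push_cast
      rw [add_sub_cancel_left]
      ring
    simp_rw [this, h k, smul_zero]
  simp only [hcoef, norm_zero, ne_eq, OfNat.ofNat_ne_zero, not_false_eq_true, zero_pow] at hs
  have h0 := hasSum_zero.unique hs
  rw [add_sub_cancel_left, smul_eq_mul, zero_eq_mul, or_iff_right (inv_ne_zero hP.ne'),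
    intervalIntegral.integral_of_le hab.le, ← integral_Ico_eq_integral_Ioc,
    integral_eq_zero_iff_of_nonneg (fun x => by positivity)] at h0
  · rw [← ae_restrict_iff' measurableSet_Ico]
    filter_upwards [h0] with x hx
    simpa using hx
  · exact (hf.restrict _).integrable_norm_pow (by norm_num)

lemma setIntegral_Ico_freqExp_eq_zero {a P : ℝ} (hP : 0 < P) {k : ℤ} (hk : k ≠ 0) :
    ∫ x in Set.Ico a (a + P), freqExp (k / P) x = 0 := by
  have hk' : (k : ℝ) / P ≠ 0 := div_ne_zero (by exact_mod_cast hk) hP.ne'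
  rw [setIntegral_Ico_freqExp (by linarith) hk', add_sub_cancel_left, mul_assoc,
    div_mul_cancel₀ _ hP.ne', mul_comm Real.pi, Real.sin_int_mul_pi]
  simp

lemma countable_of_forall_eq_mul_int {T : Set ℝ} {c : ℝ} (hT : ∀ t ∈ T, ∃ k : ℤ, t = c * k) :
    T.Countable :=
  (Set.countable_range fun k : ℤ => c * k).mono fun t ht => (hT t ht).imp fun _ hk => hk.symm

lemma isDiscrete_prod_of_forall_eq_mul_int {T S : Set ℝ} {c d : ℝ} (hc : 0 < c) (hd : 0 < d)
    (hT : ∀ t ∈ T, ∃ k : ℤ, t = c * k) (hS : ∀ s ∈ S, ∃ k : ℤ, s = d * k) :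
    IsDiscrete (T ×ˢ S) := by
  have key : ∀ {e : ℝ}, 0 < e → ∀ k l : ℤ, e * k ≠ e * l → e ≤ dist (e * k) (e * l) := by
    intro e he k l hne
    have hkl : k ≠ l := fun h => hne (by rw [h])
    rw [Real.dist_eq, ← mul_sub, abs_mul, abs_of_pos he]
    have : (1 : ℝ) ≤ |(k : ℝ) - l| := by
      exact_mod_cast Int.one_le_abs (sub_ne_zero.2 hkl)
    nlinarith
  refine ⟨DiscreteTopology.of_forall_le_dist (r := min c d) (lt_min hc hd) ?_⟩
  rintro ⟨⟨t, s⟩, ht, hs⟩ ⟨⟨t', s'⟩, ht', hs'⟩ hne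
  obtain ⟨k, rfl⟩ := hT t ht
  obtain ⟨l, rfl⟩ := hT t' ht'
  obtain ⟨i, rfl⟩ := hS s hs
  obtain ⟨j, rfl⟩ := hS s' hs'
  rw [Subtype.dist_eq, Prod.dist_eq]
  by_cases h1 : c * (k : ℝ) = c * l
  · have h2 : d * (i : ℝ) ≠ d * j := fun h2 => hne (Subtype.ext (Prod.ext h1 h2))
    exact ((min_le_right _ _).trans (key hd i j h2)).trans (le_max_right _ _)
  · exact ((min_le_left _ _).trans (key hc k l h1)).trans (le_max_left _ _)

/-- A tile which carries an orthogonal basis of exponentials generates a Gabor orthonormal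
basis. -/
lemma isGaborONB_of_tiling_of_spectrum {Ω T S : Set ℝ} (hΩ : MeasurableSet Ω)
    (hvol : volume Ω = 1) {c d : ℝ} (hc : 0 < c) (hd : 0 < d)
    (hT : ∀ t ∈ T, ∃ k : ℤ, t = c * k) (hS : ∀ s ∈ S, ∃ k : ℤ, s = d * k)
    (huniq : ∀ x, ∀ s ∈ T, ∀ t ∈ T, x - s ∈ Ω → x - t ∈ Ω → s = t)
    (hcov : ∀ x, ∃ t ∈ T, x - t ∈ Ω)
    (horth : ∀ r ∈ S, ∀ s ∈ S, r ≠ s → ∫ x in Ω, freqExp (s - r) x = 0)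
    (htotal : ∀ f : ℝ → ℂ, MemLp f 2 volume → (∀ s ∈ S, ∫ x in Ω, freqExp (-s) x * f x = 0) →
      ∀ᵐ x : ℝ, x ∈ Ω → f x = 0) :
    IsGaborONB (charWindow Ω) (T ×ˢ S) := by
  have hfin : volume Ω ≠ ∞ := by simp [hvol]
  set v : ↥(T ×ˢ S) → Lp ℂ 2 (volume : Measure ℝ) :=
    fun p => (memLp_timeFreqShift hΩ hfin p).toLp with hv
  have hvae : ∀ p, v p =ᵐ[volume] timeFreqShift (charWindow Ω) p := fun p => MemLp.coeFn_toLp _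
  have hon : Orthonormal ℂ v := by
    classical
    rw [orthonormal_iff_ite]
    intro p q
    rw [inner_timeFreqShift hΩ (hvae p) (hvae q)]
    split_ifs with hpq
    · rw [hpq, sub_self, sub_self, ambiguity_zero, freqExp_zero_freq, hvol]
      simp
    · refine mul_eq_zero_of_right _ ?_
      rw [ambiguity]
      -- Equal translations reduce to orthogonality of exponentials on Ω; distinct ones have
      -- disjoint supports.
      by_cases h1 : p.1.1 = q.1.1
      · have h2 : p.1.2 ≠ q.1.2 := fun h2 => hpq (Subtype.ext (Prod.ext h1 h2))
        rw [Prod.fst_sub, Prod.snd_sub, h1, sub_self,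
          show overlap Ω 0 = Ω by ext; simp [overlap]]
        exact horth _ p.2.2 _ q.2.2 h2
      · have : overlap Ω (q.1 - p.1).1 = ∅ := by
          refine Set.eq_empty_of_forall_notMem fun x hx => h1 ?_
          refine huniq (x + p.1.1) _ p.2.1 _ q.2.1 (by rw [add_sub_cancel_right]; exact hx.1) ?_
          have := hx.2
          rw [Set.mem_preimage, Prod.fst_sub] at this
          rwa [show x + p.1.1 - q.1.1 = x - (q.1.1 - p.1.1) by ring]
        rw [this, setIntegral_empty]
  have hTc := countable_of_forall_eq_mul_int hT
  refine ⟨hTc.prod (countable_of_forall_eq_mul_int hS),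
    isDiscrete_prod_of_forall_eq_mul_int hc hd hT hS, HilbertBasis.mkOfOrthogonalEqBot hon ?_, ?_⟩
  · rw [Submodule.eq_bot_iff]
    intro f hf
    have hf0 : ∀ p, inner ℂ (v p) f = 0 := fun p =>
      (Submodule.mem_orthogonal _ _).1 hf _ (Submodule.subset_span ⟨p, rfl⟩)
    -- Completeness is local: f vanishes on each tile by totality of the exponentials there, and
    -- countably many tiles cover the line.
    have hzero : ∀ t ∈ T, ∀ᵐ x : ℝ, x - t ∈ Ω → f x = 0 := by
      intro t ht
      have hmem : MemLp (fun x => f (x + t)) 2 volume := memLp_comp_add (Lp.memLp f) t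
      have hae := htotal _ hmem fun s hs => by
        have h0 := hf0 ⟨(t, s), ht, hs⟩
        rw [L2.inner_def] at h0
        have h1 : ∫ x, inner ℂ (v ⟨(t, s), ht, hs⟩ x) (f x)
            = freqExp (-s) t * ∫ x in Ω, freqExp (-s) x * f (x + t) := by
          rw [← integral_indicator hΩ, ← integral_const_mul,
            ← integral_sub_right_eq_self (fun x => freqExp (-s) t *
              Ω.indicator (fun x => freqExp (-s) x * f (x + t)) x) t]
          refine integral_congr_ae ?_
          filter_upwards [hvae ⟨(t, s), ht, hs⟩] with x hx
          rw [hx, RCLike.inner_apply, timeFreqShift_apply, map_mul, conj_freqExp]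
          by_cases hxt : x - t ∈ Ω
          · simp only [charWindow, hxt, Set.indicator_of_mem, map_one, one_mul]
            rw [← mul_assoc, ← freqExp_add, add_sub_cancel, sub_add_cancel, mul_comm]
          · simp [charWindow, hxt]
        rw [h1] at h0
        exact (mul_eq_zero.1 h0).resolve_left (freqExp_ne_zero _ _)
      filter_upwards [ae_sub_right hae t] with x hx hxt
      simpa using hx hxt
    have hall := (ae_ball_iff hTc).2 hzero
    rw [Lp.eq_zero_iff_ae_eq_zero]
    filter_upwards [hall] with x hx
    obtain ⟨t, ht, hxt⟩ := hcov x
    exact hx t ht hxt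
  · intro p
    rw [HilbertBasis.coe_mkOfOrthogonalEqBot]
    exact hvae p

lemma tilesLine_of_exact {Ω T : Set ℝ}
    (huniq : ∀ x, ∀ s ∈ T, ∀ t ∈ T, x - s ∈ Ω → x - t ∈ Ω → s = t)
    (hcov : ∀ x, ∃ t ∈ T, x - t ∈ Ω) : TilesLine Ω :=
  tilesLine_of_ae_exists (Filter.Eventually.of_forall hcov) huniq

/-! ### Integer gap: Ω is [0, 1) modulo 1. -/

section IntegerGap

variable {α : ℝ} {n : ℕ}

lemma integerGap_unique {x : ℝ} {a b : ℤ} (ha : x - a ∈ twoIntervals α n)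
    (hb : x - b ∈ twoIntervals α n) (hα : 0 ≤ α) (hα' : α ≤ 1) : a = b := by
  have key : ∀ k : ℤ, (-1 : ℝ) < k → (k : ℝ) < 1 → k = 0 := by
    intro k h1 h2
    have h1' : (-1 : ℤ) < k := by exact_mod_cast h1
    have h2' : k < 1 := by exact_mod_cast h2
    omega
  rcases ha with ⟨h1, h2⟩ | ⟨h1, h2⟩ <;> rcases hb with ⟨h3, h4⟩ | ⟨h3, h4⟩
  · have := key (a - b) (by push_cast; linarith) (by push_cast; linarith)
    omega
  · have := key (a - b - n) (by push_cast; linarith) (by push_cast; linarith)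
    have h5 : (a : ℝ) = b + n := by exact_mod_cast (by omega : a = b + n)
    linarith
  · have := key (b - a - n) (by push_cast; linarith) (by push_cast; linarith)
    have h5 : (b : ℝ) = a + n := by exact_mod_cast (by omega : b = a + n)
    linarith
  · have := key (a - b) (by push_cast; linarith) (by push_cast; linarith)
    omega

lemma integerGap_cover (α : ℝ) (n : ℕ) (x : ℝ) : ∃ a : ℤ, x - a ∈ twoIntervals α n := by
  have h0 := Int.fract_nonneg x
  have h1 := Int.fract_lt_one x
  have h2 := Int.floor_add_fract x
  rcases lt_or_ge (Int.fract x) α with h | h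
  · exact ⟨⌊x⌋, Or.inl ⟨by linarith, by linarith⟩⟩
  · refine ⟨⌊x⌋ - n, Or.inr ⟨?_, ?_⟩⟩ <;> push_cast <;> linarith

lemma tilesLine_of_integerGap (hα : 0 ≤ α) (hα' : α ≤ 1) : TilesLine (twoIntervals α n) := by
  refine tilesLine_of_exact (T := Set.range ((↑) : ℤ → ℝ)) ?_ fun x => ?_
  · rintro x _ ⟨a, rfl⟩ _ ⟨b, rfl⟩ ha hb
    rw [integerGap_unique ha hb hα hα']
  · obtain ⟨a, ha⟩ := integerGap_cover α n x
    exact ⟨a, ⟨a, rfl⟩, ha⟩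

lemma freqExp_int_mul_nat (k : ℤ) (n : ℕ) : freqExp k n = 1 :=
  freqExp_eq_one_iff.2 ⟨n * k, by push_cast; ring⟩

lemma setIntegral_Ico_add_adjacent {a b c : ℝ} (hab : a ≤ b) (hbc : b ≤ c) {f : ℝ → ℂ}
    (hf : MemLp f 2 volume) :
    (∫ x in Set.Ico a b, f x) + ∫ x in Set.Ico b c, f x = ∫ x in Set.Ico a c, f x := by
  rw [← Set.Ico_union_Ico_eq_Ico hab hbc, setIntegral_union Set.Ico_disjoint_Ico_same
    measurableSet_Ico (integrableOn_Ico_of_memLp hf _ _) (integrableOn_Ico_of_memLp hf _ _)]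

/-- The two pieces of `f`, moved next to each other. -/
def glue (α β : ℝ) (f : ℝ → ℂ) (x : ℝ) : ℂ := if x < α then f x else f (x + β)

lemma memLp_glue {β : ℝ} {f : ℝ → ℂ} (hf : MemLp f 2 volume) : MemLp (glue α β f) 2 volume := by
  have h : glue α β f = (Set.Iio α).indicator f + (Set.Ici α).indicator fun x => f (x + β) := by
    ext x
    by_cases hx : x < α
    · simp [glue, hx]
    · simp [glue, hx, not_lt.1 hx]
  rw [h]
  exact (hf.indicator measurableSet_Iio).add ((memLp_comp_add hf β).indicator measurableSet_Ici)

/-- Integer frequencies do not see the shift by n, so these are Fourier integrals on [0, 1). -/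
lemma setIntegral_twoIntervals_eq_glue (hα : 0 ≤ α) (hα' : α ≤ 1) {f : ℝ → ℂ}
    (hf : MemLp f 2 volume) (k : ℤ) :
    ∫ x in twoIntervals α n, freqExp k x * f x
      = ∫ x in Set.Ico 0 1, freqExp k x * glue α n f x := by
  rw [setIntegral_twoIntervals n.cast_nonneg (memLp_freqExp_mul hf _),
    ← setIntegral_Ico_add_adjacent hα hα' (memLp_freqExp_mul (memLp_glue hf) k)]
  congr 1
  · refine setIntegral_congr_fun measurableSet_Ico fun x hx => ?_
    simp only [glue, hx.2, if_true]
  · refine setIntegral_congr_fun measurableSet_Ico fun x hx => ?_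
    simp only [glue, not_lt.2 hx.1, if_false, freqExp_add, freqExp_int_mul_nat, mul_one]

lemma isGaborONB_of_integerGap (hα : 0 ≤ α) (hα' : α ≤ 1) :
    ∃ Λ, IsGaborONB (charWindow (twoIntervals α n)) Λ := by
  refine ⟨_, isGaborONB_of_tiling_of_spectrum (T := Set.range ((↑) : ℤ → ℝ))
    (S := Set.range ((↑) : ℤ → ℝ)) (measurableSet_twoIntervals _ _)
    (volume_twoIntervals hα hα' n.cast_nonneg) one_pos one_pos ?_ ?_ ?_ ?_ ?_ ?_⟩
  · rintro _ ⟨k, rfl⟩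
    exact ⟨k, (one_mul _).symm⟩
  · rintro _ ⟨k, rfl⟩
    exact ⟨k, (one_mul _).symm⟩
  · rintro x _ ⟨a, rfl⟩ _ ⟨b, rfl⟩ ha hb
    rw [integerGap_unique ha hb hα hα']
  · intro x
    obtain ⟨a, ha⟩ := integerGap_cover α n x
    exact ⟨a, ⟨a, rfl⟩, ha⟩
  · rintro _ ⟨a, rfl⟩ _ ⟨b, rfl⟩ hne
    have hba : b - a ≠ 0 := sub_ne_zero.2 fun h => hne (by rw [h])
    have h0 := setIntegral_Ico_freqExp_eq_zero (a := 0) one_pos hba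
    rw [twoIntervals, setIntegral_union_Ico_freqExp (by linarith [n.cast_nonneg (α := ℝ)]),
      setIntegral_Ico_freqExp_add, ← Int.cast_sub, freqExp_int_mul_nat, one_mul,
      ← setIntegral_union_Ico_freqExp le_rfl, Set.Ico_union_Ico_eq_Ico hα hα']
    simpa using h0
  · intro f hf h
    have hz := ae_eq_zero_of_fourier_eq_zero (memLp_glue (α := α) (β := n) hf) (a := 0) one_pos
      fun k => by
        have := h k ⟨k, rfl⟩
        rw [← Int.cast_neg, setIntegral_twoIntervals_eq_glue hα hα' hf] at this
        simpa using this
    filter_upwards [hz, ae_sub_right hz n] with x h1 h2 hx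
    rcases hx with hx | hx
    · have := h1 ⟨hx.1, by linarith [hx.2]⟩
      rwa [glue, if_pos hx.2] at this
    · have := h2 ⟨by linarith [hx.1], by linarith [hx.2]⟩
      rwa [glue, if_neg (by linarith [hx.1]), sub_add_cancel] at this

end IntegerGap

/-! ### Two halves whose left endpoints are an integer m apart. -/

section HalfInterval

variable {β : ℝ} {m : ℕ}

/-- Translations which tile the line by two intervals of length `1 / 2` at distance `m`. -/
def halfTranslations (m : ℕ) : Set ℝ :=
  {t | ∃ k j ε : ℤ, 0 ≤ j ∧ j < m ∧ 0 ≤ ε ∧ ε < 2 ∧ t = (1 / 2) * (2 * (j + 2 * m * k) + ε : ℤ)}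

/-- In cells of length 1/2, Ω occupies exactly cells 0 and 2m. -/
lemma sub_mem_twoIntervals_half (hβ : β + 1 / 2 = m) {x : ℝ} {a : ℤ} :
    x - (1 / 2) * a ∈ twoIntervals (1 / 2) β ↔ ⌊2 * x⌋ = a ∨ ⌊2 * x⌋ = a + 2 * m := by
  rw [twoIntervals, Set.mem_union, Set.mem_Ico, Set.mem_Ico, Int.floor_eq_iff, Int.floor_eq_iff]
  push_cast
  constructor
  · rintro (⟨h1, h2⟩ | ⟨h1, h2⟩)
    · exact Or.inl ⟨by linarith, by linarith⟩
    · exact Or.inr ⟨by linarith, by linarith⟩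
  · rintro (⟨h1, h2⟩ | ⟨h1, h2⟩)
    · exact Or.inl ⟨by linarith, by linarith⟩
    · exact Or.inr ⟨by linarith, by linarith⟩

/-- Write a cell index as 2d + ε. The residues j and j + m with 0 ≤ j < m represent each d modulo 2m
once, so a cell determines its translate. -/
lemma halfTranslations_unique (hβ : β + 1 / 2 = m) (x : ℝ) :
    ∀ s ∈ halfTranslations m, ∀ t ∈ halfTranslations m, x - s ∈ twoIntervals (1 / 2) β →
      x - t ∈ twoIntervals (1 / 2) β → s = t := by
  have key : ∀ k k' d d' : ℤ, 0 ≤ d → d < 2 * m → 0 ≤ d' → d' < 2 * m →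
      d + 2 * m * k = d' + 2 * m * k' → d = d' := by
    intro k k' d d' h1 h2 h3 h4 h
    have h5 := congrArg (· % (2 * m : ℤ)) h
    simp only [Int.add_mul_emod_self_left] at h5
    rwa [Int.emod_eq_of_lt h1 h2, Int.emod_eq_of_lt h3 h4] at h5
  rintro _ ⟨k, j, ε, hj0, hjm, hε0, hε2, rfl⟩ _ ⟨k', j', ε', hj0', hjm', hε0', hε2', rfl⟩ hs ht
  rw [sub_mem_twoIntervals_half hβ] at hs ht
  rcases hs with hs | hs <;> rcases ht with ht | ht
  · rw [hs] at ht
    rw [ht]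
  · have := key k k' j (j' + m) (by omega) (by omega) (by omega) (by omega) (by
      generalize (2 * m * k : ℤ) = K at *
      generalize (2 * m * k' : ℤ) = K' at *
      omega)
    omega
  · have := key k k' (j + m) j' (by omega) (by omega) (by omega) (by omega) (by
      generalize (2 * m * k : ℤ) = K at *
      generalize (2 * m * k' : ℤ) = K' at *
      omega)
    omega
  · rw [hs] at ht
    rw [add_right_cancel ht]

lemma halfTranslations_cover (hm : 0 < m) (hβ : β + 1 / 2 = m) (x : ℝ) :
    ∃ t ∈ halfTranslations m, x - t ∈ twoIntervals (1 / 2) β := by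
  have hm' : (0 : ℤ) < 2 * m := by omega
  have h1 := Int.emod_add_mul_ediv (⌊2 * x⌋ / 2) (2 * m)
  have h2 := Int.emod_nonneg (⌊2 * x⌋ / 2) hm'.ne'
  have h3 := Int.emod_lt_of_pos (⌊2 * x⌋ / 2) hm'
  set k := ⌊2 * x⌋ / 2 / (2 * m : ℤ)
  set r := ⌊2 * x⌋ / 2 % (2 * m : ℤ)
  rcases lt_or_ge r m with h | h
  · refine ⟨_, ⟨k, r, ⌊2 * x⌋ % 2, h2, h, by omega, by omega, rfl⟩, ?_⟩
    rw [sub_mem_twoIntervals_half hβ]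
    left
    omega
  · refine ⟨_, ⟨k, r - m, ⌊2 * x⌋ % 2, by omega, by omega, by omega, by omega, rfl⟩, ?_⟩
    rw [sub_mem_twoIntervals_half hβ]
    right
    generalize (2 * m * k : ℤ) = K at *
    omega

lemma tilesLine_half (hm : 0 < m) (hβ : β + 1 / 2 = m) : TilesLine (twoIntervals (1 / 2) β) :=
  tilesLine_of_exact (halfTranslations_unique hβ) (halfTranslations_cover hm hβ)

/-- Frequencies of an orthogonal basis of exponentials for two intervals of length `1 / 2` at
distance `m`. -/
def halfSpectrum (m : ℕ) : Set ℝ :=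
  {s | ∃ k ε : ℤ, 0 ≤ ε ∧ ε < 2 ∧ s = 2 * k + ε / (2 * m)}

lemma setIntegral_twoIntervals_half (hβ : β + 1 / 2 = m) (hβ0 : 0 ≤ β) {f : ℝ → ℂ}
    (hf : MemLp f 2 volume) :
    ∫ x in twoIntervals (1 / 2) β, f x = ∫ x in Set.Ico (0 : ℝ) (0 + 1 / 2), (f x + f (x + m)) := by
  rw [integral_add (integrableOn_Ico_of_memLp hf _ _)
    (integrableOn_Ico_of_memLp (memLp_comp_add hf _) _ _), setIntegral_twoIntervals hβ0 hf,
    zero_add, ← setIntegral_Ico_add, ← setIntegral_Ico_add]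
  rw [show (1 / 2 + β : ℝ) = 0 + m by linarith, show (1 + β : ℝ) = 1 / 2 + m by linarith]

lemma isGaborONB_half (hm : 0 < m) (hβ : β + 1 / 2 = m) (hβ0 : 0 ≤ β) :
    ∃ Λ, IsGaborONB (charWindow (twoIntervals (1 / 2) β)) Λ := by
  have hmR : (0 : ℝ) < m := by exact_mod_cast hm
  refine ⟨_, isGaborONB_of_tiling_of_spectrum (T := halfTranslations m) (S := halfSpectrum m)
    (measurableSet_twoIntervals _ _) (volume_twoIntervals (by norm_num) (by norm_num) hβ0)
    (c := 1 / 2) (d := 1 / (2 * m)) (by norm_num) (by positivity) ?_ ?_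
    (halfTranslations_unique hβ) (halfTranslations_cover hm hβ) ?_ ?_⟩
  · rintro _ ⟨k, j, ε, -, -, -, -, rfl⟩
    exact ⟨_, rfl⟩
  · rintro _ ⟨k, ε, -, -, rfl⟩
    refine ⟨4 * m * k + ε, ?_⟩
    push_cast
    field_simp
    ring
  · rintro _ ⟨k, ε, hε0, hε2, rfl⟩ _ ⟨l, δ, hδ0, hδ2, rfl⟩ hne
    rw [twoIntervals, setIntegral_union_Ico_freqExp (by linarith),
      show (1 / 2 + β : ℝ) = 0 + m by linarith, show (1 + β : ℝ) = 1 / 2 + m by linarith,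
      setIntegral_Ico_freqExp_add, ← one_add_mul]
    -- Within a class the frequencies differ by even integers, orthogonal on an interval of length
    -- 1/2. Across classes the translation by m contributes the factor -1, and the two pieces
    -- cancel.
    by_cases hεδ : ε = δ
    · subst hεδ
      have hkl : l - k ≠ 0 := sub_ne_zero.2 fun h => hne (by rw [h])
      have h0 := setIntegral_Ico_freqExp_eq_zero (a := 0) (P := 1 / 2) (by norm_num) hkl
      refine mul_eq_zero_of_right _ ?_
      rwa [zero_add, show ((l - k : ℤ) : ℝ) / (1 / 2)
        = 2 * l + ε / (2 * m) - (2 * k + ε / (2 * m)) by push_cast; ring] at h0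
    · refine mul_eq_zero_of_left ?_ _
      have hodd : δ - ε = 1 ∨ δ - ε = -1 := by omega
      have : freqExp (2 * l + δ / (2 * m) - (2 * k + ε / (2 * m))) m = -1 := by
        rw [freqExp_eq_neg_one_iff]
        have hval : (m : ℝ) * (2 * l + δ / (2 * m) - (2 * k + ε / (2 * m)))
            = 2 * m * (l - k) + ((δ - ε : ℤ) : ℝ) / 2 := by
          push_cast
          field_simp
          ring
        rw [hval]
        rcases hodd with h | h <;> rw [h]
        · exact ⟨2 * m * (l - k), by push_cast; ring⟩
        · exact ⟨2 * m * (l - k) - 1, by push_cast; ring⟩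
      rw [this]
      ring
  · intro f hf h
    have hfm := memLp_comp_add hf m
    -- The frequencies 2k take the value 1 at m and detect f(x) + f(x + m); the frequencies 2k +
    -- 1/(2m) take the value -1 there and detect f(x) - f(x + m).
    have hsum := ae_eq_zero_of_fourier_eq_zero (hf.add hfm) (a := 0) (P := 1 / 2) (by norm_num)
      fun k => by
        have h0 := h (2 * k) ⟨k, 0, le_rfl, by norm_num, by simp⟩
        rw [setIntegral_twoIntervals_half hβ hβ0 (memLp_freqExp_mul hf _)] at h0
        rw [← h0]
        refine setIntegral_congr_fun measurableSet_Ico fun x _ => ?_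
        have hper : freqExp (-(2 * k)) m = 1 :=
          freqExp_eq_one_iff.2 ⟨-(2 * m * k), by push_cast; ring⟩
        simp only [Pi.add_apply, freqExp_add, hper, mul_one,
          show -((k : ℝ) / (1 / 2)) = -(2 * k) by ring]
        ring
    have hdiff := ae_eq_zero_of_fourier_eq_zero
      (memLp_freqExp_mul (hf.sub hfm) (-(1 / (2 * m)))) (a := 0) (P := 1 / 2) (by norm_num)
      fun k => by
        have h0 := h (2 * k + 1 / (2 * m)) ⟨k, 1, by norm_num, by norm_num, by simp⟩
        rw [setIntegral_twoIntervals_half hβ hβ0 (memLp_freqExp_mul hf _)] at h0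
        rw [← h0]
        refine setIntegral_congr_fun measurableSet_Ico fun x _ => ?_
        have hper : freqExp (-(2 * k + 1 / (2 * m))) m = -1 := by
          refine freqExp_eq_neg_one_iff.2 ⟨-(2 * m * k) - 1, ?_⟩
          push_cast
          field_simp
          ring
        simp only [Pi.sub_apply, freqExp_add, hper,
          show -((k : ℝ) / (1 / 2)) = -(2 * k) by ring]
        rw [neg_add, freqExp_add_freq]
        ring
    have hboth : ∀ᵐ x : ℝ, x ∈ Set.Ico (0 : ℝ) (0 + 1 / 2) → f x = 0 ∧ f (x + m) = 0 := by
      filter_upwards [hsum, hdiff] with x h1 h2 hx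
      have h3 := h1 hx
      have h4 := (mul_eq_zero.1 (h2 hx)).resolve_left (freqExp_ne_zero _ _)
      simp only [Pi.add_apply, Pi.sub_apply] at h3 h4
      constructor
      · linear_combination (h3 + h4) / 2
      · linear_combination (h3 - h4) / 2
    filter_upwards [hboth, ae_sub_right hboth m] with x h1 h2 hx
    rcases hx with hx | hx
    · exact (h1 ⟨hx.1, by linarith [hx.2]⟩).1
    · have := (h2 ⟨by linarith [hx.1], by linarith [hx.2]⟩).2
      rwa [sub_add_cancel] at this

end HalfInterval

/-! ### The case α = 0: a unit interval. -/

section Interval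

lemma twoIntervals_zero (β : ℝ) : twoIntervals 0 β = Set.Ico β (β + 1) := by
  simp [twoIntervals, add_comm]

lemma floor_unique_of_sub_mem {β x : ℝ} {a : ℤ} (h : x - a ∈ Set.Ico β (β + 1)) :
    ⌊x - β⌋ = a :=
  Int.floor_eq_iff.2 ⟨by linarith [h.1], by linarith [h.2]⟩

lemma sub_floor_mem (β x : ℝ) : x - ⌊x - β⌋ ∈ Set.Ico β (β + 1) :=
  ⟨by linarith [Int.floor_le (x - β)], by linarith [Int.lt_floor_add_one (x - β)]⟩

lemma tilesLine_Ico (β : ℝ) : TilesLine (Set.Ico β (β + 1)) := by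
  refine tilesLine_of_exact (T := Set.range ((↑) : ℤ → ℝ)) ?_
    fun x => ⟨_, ⟨_, rfl⟩, sub_floor_mem β x⟩
  rintro x _ ⟨a, rfl⟩ _ ⟨b, rfl⟩ ha hb
  rw [← floor_unique_of_sub_mem ha, ← floor_unique_of_sub_mem hb]

lemma isGaborONB_Ico (β : ℝ) : ∃ Λ, IsGaborONB (charWindow (Set.Ico β (β + 1))) Λ := by
  refine ⟨_, isGaborONB_of_tiling_of_spectrum (T := Set.range ((↑) : ℤ → ℝ))
    (S := Set.range ((↑) : ℤ → ℝ)) measurableSet_Ico (by simp) one_pos one_pos ?_ ?_ ?_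
    (fun x => ⟨_, ⟨_, rfl⟩, sub_floor_mem β x⟩) ?_ ?_⟩
  · rintro _ ⟨k, rfl⟩
    exact ⟨k, (one_mul _).symm⟩
  · rintro _ ⟨k, rfl⟩
    exact ⟨k, (one_mul _).symm⟩
  · rintro x _ ⟨a, rfl⟩ _ ⟨b, rfl⟩ ha hb
    rw [← floor_unique_of_sub_mem ha, ← floor_unique_of_sub_mem hb]
  · rintro _ ⟨a, rfl⟩ _ ⟨b, rfl⟩ hne
    have hba : b - a ≠ 0 := sub_ne_zero.2 fun h => hne (by rw [h])
    simpa using setIntegral_Ico_freqExp_eq_zero (a := β) one_pos hba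
  · intro f hf h
    exact ae_eq_zero_of_fourier_eq_zero hf one_pos fun k => by
      simpa using h k ⟨k, rfl⟩

end Interval

/-! ### Half-integer gaps by parity, and the main theorem. -/

lemma odd_half_gap {n : ℕ} (hn : ¬ Even n) :
    ∃ m : ℕ, 0 < m ∧ (n : ℝ) / 2 + 1 / 2 = m := by
  obtain ⟨k, rfl⟩ := Nat.not_even_iff_odd.1 hn
  exact ⟨k + 1, k.succ_pos, by push_cast; ring⟩

lemma even_half_gap {n : ℕ} (hn : Even n) : ∃ k : ℕ, (n : ℝ) / 2 = k := by
  obtain ⟨k, rfl⟩ := hn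
  exact ⟨k, by push_cast; ring⟩

lemma tilesLine_and_isGaborONB_half_gap (n : ℕ) :
    TilesLine (twoIntervals (1 / 2) (n / 2)) ∧
      ∃ Λ, IsGaborONB (charWindow (twoIntervals (1 / 2) (n / 2))) Λ := by
  by_cases hn : Even n
  · obtain ⟨k, hk⟩ := even_half_gap hn
    rw [hk]
    exact ⟨tilesLine_of_integerGap (by norm_num) (by norm_num),
      isGaborONB_of_integerGap (by norm_num) (by norm_num)⟩
  · obtain ⟨m, hm, hβ⟩ := odd_half_gap hn
    exact ⟨tilesLine_half hm hβ, isGaborONB_half hm hβ (by positivity)⟩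

end

/-- Here `ℕ` contains 0, but 0 < β excludes that value of n. -/
theorem mainTheorem2 (α β : ℝ) (hα : 0 ≤ α) (hβ : 0 < β)
    (h : α < 1 / 2 ∨ (α = 1 / 2 ∧ 1 / 2 ≤ β)) :
    ((∃ Λ : Set (ℝ × ℝ), IsGaborONB (charWindow (twoIntervals α β)) Λ) ↔
        TilesLine (twoIntervals α β)) ∧
      (0 < α →
        (TilesLine (twoIntervals α β) ↔
          ((0 < α ∧ α < 1 / 2 ∧ ∃ n : ℕ, β = n) ∨
            (α = 1 / 2 ∧ ∃ n : ℕ, β = n / 2)))) := by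
  rcases hα.eq_or_lt with rfl | hα0
  · rw [twoIntervals_zero]
    exact ⟨iff_of_true (isGaborONB_Ico β) (tilesLine_Ico β), fun h0 => absurd h0 (lt_irrefl _)⟩
  rcases h with hlt | ⟨rfl, hβ'⟩
  · have hclass : TilesLine (twoIntervals α β) ↔ ∃ n : ℕ, β = n := by
      refine ⟨fun hT => hT.exists_nat hα0 hlt hβ, ?_⟩
      rintro ⟨n, rfl⟩
      exact tilesLine_of_integerGap hα (by linarith)
    refine ⟨⟨?_, fun hT => ?_⟩, fun _ => ?_⟩
    · rintro ⟨Λ, hΛ⟩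
      rcases lt_or_ge β (1 - α) with hgap | hgap
      · exact absurd hΛ (not_isGaborONB_of_short_gap hα0 hlt hβ hgap Λ)
      · exact tilesLine_of_isGaborONB_of_long_gap hα0 hlt hgap hΛ
    · obtain ⟨n, rfl⟩ := hclass.1 hT
      exact isGaborONB_of_integerGap hα (by linarith)
    · rw [hclass]
      exact ⟨fun hn => Or.inl ⟨hα0, hlt, hn⟩, fun hn => hn.elim (fun h1 => h1.2.2)
        fun h1 => absurd h1.1 hlt.ne⟩
  · have hclass : TilesLine (twoIntervals (1 / 2) β) ↔ ∃ n : ℕ, β = n / 2 := by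
      refine ⟨fun hT => hT.exists_nat_half hβ, ?_⟩
      rintro ⟨n, rfl⟩
      exact (tilesLine_and_isGaborONB_half_gap n).1
    refine ⟨⟨?_, fun hT => ?_⟩, fun _ => ?_⟩
    · rintro ⟨Λ, hΛ⟩
      exact hclass.2 (exists_nat_half_of_isGaborONB_half hβ' hΛ)
    · obtain ⟨n, rfl⟩ := hclass.1 hT
      exact (tilesLine_and_isGaborONB_half_gap n).2
    · rw [hclass]
      exact ⟨fun hn => Or.inr ⟨rfl, hn⟩, fun hn => hn.elim (fun h1 => absurd h1.2.1 (lt_irrefl _))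
        fun h1 => h1.2⟩
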